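/- **Setting.** A straight-line program over a ring is a finite sequence of operations $+,-,\times$ and the constant $1$, applied to the inputs and to earlier results; its length is the number of operations. A Boolean circuit is a straight-line program over $\mathbb F_2$, each of its gates being one bit operation. Write $f=\tilde O(g)$ if $f\le C\,g\,(1+\log g)^k$ for some constants $C,k$. Let $\omega\ge 2$ be an exponent of matrix multiplication, and fix subroutines for fast arithmetic, namely families of straight-line programs $(A_m)$, $(P_d)$, $(I_n)$ such that * $A_m$ multiplies two $m\times m$ matrices over any commutative ring, and has length $\tilde O(m^\omega)$; * $P_d$ multiplies two polynomials of degree $<d$ over any commutative ring, and has length $\tilde O(d)$; * $I_n$ is a Boolean circuit that multiplies two integers of bit size at most $n$, and has length $\tilde O(n)$. Cost is the number of bit operations on a random access machine: a multiplication of two integers, the larger of bit size $n$, costs the length of $I_n$ plus a term linear in the bit sizes; addition, subtraction, comparison, shifts, truncation modulo a power of $2$ and determination of the bit size cost linear time; a read or write in an address table, and an instruction fetch of a straight-line program, cost $1$. Loop control, index computations on small counters, and rearranging pointers are not charged. All other operations are composed of these. **Algorithm `matrix_factorial`.** Input: integers $m,d\ge1$ and $N\ge2$, a matrix $M(\theta)\in\mathscr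 M_m(\mathbb Z[\theta])$ with entries of degree $<d$, and a list $\mathcal P$ of distinct primes less than $N$ (for instance, all of them). Let $\eta=\lceil\log_2N\rceil$ and, for $0\le i\le\eta$ and $0\le j<2^i$, let $U_{i,j}=\{k\in\mathbb N: jN/2^i<k\le (j+1)N/2^i\}$. 1. Determine the primes up to $N$ by the sieve of Eratosthenes. Compute all $T_{\eta,j}=\prod_{k\in U_{\eta,j}}M(\theta+k)\bmod\theta^d$ (by divide-and-conquer translation of polynomials) and all $S_{\eta,j}=\prod_{k\in U_{\eta,j},\,k\text{ prime}}k$; each $U_{\eta,j}$ has at most one element. 2. Fill the two binary trees $T_{i,j}=T_{i+1,2j}T_{i+1,2j+1}$ (over $\mathbb Z[\theta]/\theta^d$) and $S_{i,j}=S_{i+1,2j}S_{i+1,2j+1}$ from the bottom. 3. Put $W_{0,0}=1$ and, from the top, compute $W_{i+1,2j}=W_{i,j}\bmod S_{i+1,2j}$ and $W_{i+1,2j+1}=W_{i,j}T_{i+1,2j}\bmod S_{i+1,2j+1}$. 4. For every $p\in\mathcal P$, take $W_{\eta,j}$ with $S_{\eta,j}=p$, and return $M(\theta)W_{\eta,j}\bmod(p,\theta^d)$.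 Matrix products over $\mathbb Z[\theta]/\theta^d$ are computed by running $A_m$ over $(\mathbb Z/2^B)[\theta]/\theta^d$, with $P_d$ for the multiplication of polynomials, for a $B$ that exceeds the bit size of the result; division with remainder is done by Newton iteration. **Proposition.** There are constants $C$ and $k$, depending only on $\omega$ and on the families $(A_m),(P_d),(I_n)$, such that for all integers $m,d\ge 1$, $n\ge 0$, $N\ge2$, every $M(\theta)\in\mathscr M_m(\mathbb Z[\theta])$ with entries of degree less than $d$ and with all coefficients of bit size at most $n$, and every list $\mathcal P$ of distinct primes $p<N$, this algorithm returns the list of $$M(\theta)\,M(\theta+1)\cdots M(\theta+p-1)\bmod (p,\theta^d),\qquad p\in\mathcal P$$ (with coefficients in $[0,p)$), at a cost of at most $$C\,X\,(1+\log X)^k\ \text{ bit operations, where } X=m^{\omega}\,d\,N\,\bigl(n+d\log N+\log m\bigr);$$ that is, at a cost of $\tilde O\bigl(m^\omega dN(n+d\log N+\log m)\bigr)$ bit operations. -/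

import Mathlib

open Polynomial

namespace RemainderTree

/-! ### Straight-line programs over a ring -/

/-- One ring operation.  Operands are addresses of earlier values (the inputs come first). -/
inductive Instr where
  | one : Instr
  | add (i j : ℕ) : Instr
  | sub (i j : ℕ) : Instr
  | mul (i j : ℕ) : Instr

/-- A division-free straight-line program: a sequence of ring operations, each appending its result
to the memory, followed by the list of the addresses of the outputs. -/
structure SLP where
  code : List Instr
  out : List ℕ

/-- The number of ring operations that the program performs. -/
def SLP.length (s : SLP) : ℕ := s.code.length

/-- The value of an operation in the ring `R`, given the current memory. -/
def Instr.eval {R : Type} [Ring R] (mem : List R) : Instr → R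
  | .one => 1
  | .add i j => mem.getD i 0 + mem.getD j 0
  | .sub i j => mem.getD i 0 - mem.getD j 0
  | .mul i j => mem.getD i 0 * mem.getD j 0

/-- The outputs of a straight-line program run in the ring `R`. -/
def SLP.eval {R : Type} [Ring R] (s : SLP) (inp : List R) : List R :=
  let mem := s.code.foldl (fun mem c => mem ++ [c.eval mem]) inp
  s.out.map (fun i => mem.getD i 0)

/-- The `n` low-order binary digits of `a`, least significant digit first. -/
def binaryDigits (n a : ℕ) : List (ZMod 2) :=
  (List.range n).map (fun i => if a.testBit i then 1 else 0)

/-- The coefficients of `θ ^ 0, …, θ ^ (d - 1)`. -/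
noncomputable def coeffList {R : Type} [Semiring R] (d : ℕ) (f : R[X]) : List R :=
  (List.range d).map f.coeff

/-- The entries of a square matrix, row by row. -/
def entryList {α : Type} {m : ℕ} (X : Matrix (Fin m) (Fin m) α) : List α :=
  (List.finRange m).flatMap (fun i => (List.finRange m).map (fun j => X i j))

/-- `s`, run over the field with two elements (that is, as a Boolean circuit with gates `xor`, `and`
and `true`, each gate being one bit operation), multiplies integers of bit size at most `n`. -/
def MultipliesIntegers (n : ℕ) (s : SLP) : Prop :=
  ∀ a b : ℕ, a < 2 ^ n → b < 2 ^ n →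
    s.eval (binaryDigits n a ++ binaryDigits n b) = binaryDigits (2 * n) (a * b)

/-- `s` multiplies polynomials of degree less than `d` over every commutative ring. -/
def MultipliesPolynomials (d : ℕ) (s : SLP) : Prop :=
  ∀ (R : Type) [CommRing R] (f g : R[X]), f.degree < d → g.degree < d →
    s.eval (coeffList d f ++ coeffList d g) = coeffList (2 * d) (f * g)

/-- `s` multiplies square matrices of size `m` over every commutative ring. -/
def MultipliesMatrices (m : ℕ) (s : SLP) : Prop :=
  ∀ (R : Type) [CommRing R] (X Y : Matrix (Fin m) (Fin m) R),
    s.eval (entryList X ++ entryList Y) = entryList (X * Y)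

/-- The bound `C x (1 + log x) ^ k`, by which `Õ(x)` is unfolded. -/
noncomputable def softBound (C : ℝ) (k : ℕ) (x : ℝ) : ℝ := C * x * (1 + Real.log x) ^ k

/-! ### Computations on integers, with their number of bit operations

A computation returns its value and its cost, on a random access machine: the only
operations on data integers are the primitives below, each charged in bit operations.  Loop control,
index computations on small counters, and rearranging pointers are not charged. -/

structure Comp (α : Type) where
  val : α
  cost : ℕ

instance : Monad Comp where
  pure a := ⟨a, 0⟩
  bind x f := ⟨(f x.val).val, x.cost + (f x.val).cost⟩

/-- The bit size of an integer (without its sign). -/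
def bits (x : ℤ) : ℕ := x.natAbs.size

namespace Comp

def tick : Comp Unit := ⟨(), 1⟩

def add (x y : ℤ) : Comp ℤ := ⟨x + y, bits x + bits y + 1⟩

def sub (x y : ℤ) : Comp ℤ := ⟨x - y, bits x + bits y + 1⟩

def lt (x y : ℤ) : Comp Bool := ⟨decide (x < y), bits x + bits y + 1⟩

def bitSize (x : ℤ) : Comp ℕ := ⟨bits x, bits x + 1⟩

/-- Left shift. -/
def shl (x : ℤ) (k : ℕ) : Comp ℤ := ⟨x * 2 ^ k, bits x + k + 1⟩

/-- Right shift (rounding down). -/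
def shr (x : ℤ) (k : ℕ) : Comp ℤ := ⟨x / 2 ^ k, bits x + k + 1⟩

/-- The `k` low-order digits, i.e. the residue modulo `2 ^ k` in `[0, 2 ^ k)`. -/
def low (k : ℕ) (x : ℤ) : Comp ℤ := ⟨x % 2 ^ k, bits x + k + 1⟩

/-- Multiplication of two integers by means of the circuit `I n`, where `n` is the larger of their
two bit sizes; its cost is the number of gates of that circuit, and a linear term for the signs,
for reading the operands and for writing the result. -/
def mul (I : ℕ → SLP) (x y : ℤ) : Comp ℤ :=
  ⟨x * y, (I (max (bits x) (bits y))).length + bits x + bits y + 1⟩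

/-- Memory access. -/
def load {α : Type} (f : ℕ → α) (i : ℕ) : Comp α := ⟨f i, 1⟩

def store {α : Type} (f : ℕ → α) (i : ℕ) (a : α) : Comp (ℕ → α) := ⟨Function.update f i a, 1⟩

/-- Apply a computation to all elements of a list, one after the other. -/
def map {α β : Type} (f : α → Comp β) : List α → Comp (List β)
  | [] => pure []
  | a :: l => do
    let b ← f a
    let r ← map f l
    pure (b :: r)

def zip {α β γ : Type} (f : α → β → Comp γ) : List α → List β → Comp (List γ)
  | a :: l, b :: l' => do
    let c ← f a b
    let r ← zip f l l'
    pure (c :: r)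
  | _, _ => pure []

def fold {α β : Type} (f : β → α → Comp β) : β → List α → Comp β
  | b, [] => pure b
  | b, a :: l => do
    let b' ← f b a
    fold f b' l

end Comp

/-- The largest bit size of the elements of a list. -/
def maxBits : List ℤ → Comp ℕ
  | [] => pure 0
  | x :: l => do
    let b ← Comp.bitSize x
    let r ← maxBits l
    pure (max b r)

/-! ### Division with remainder by Newton iteration -/

/-- An approximation of `2 ^ (s + 2 ^ t) / S`, where `s` is the bit size of `S`. -/
def reciprocal (I : ℕ → SLP) (S : ℤ) (s : ℕ) : ℕ → Comp ℤ
  | 0 => pure 3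
  | t + 1 => do
    let v ← reciprocal I S s t
    let a ← Comp.shl v (2 ^ t + 1)
    let w ← Comp.mul I v v
    let u ← Comp.mul I S w
    let u' ← Comp.shr u s
    Comp.sub a u'

/-- The remainder of `x` modulo `S > 0`, in `[0, S)`. -/
def intMod (I : ℕ → SLP) (x S : ℤ) : Comp ℤ := do
  let L ← Comp.bitSize x
  let s ← Comp.bitSize S
  let t := Nat.clog 2 L
  let v ← reciprocal I S s t
  let y ← Comp.mul I x v
  let q ← Comp.shr y (s + 2 ^ t)
  let z ← Comp.mul I q S
  let r ← Comp.sub x z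
  let neg ← Comp.lt r 0
  if neg then Comp.add r S
  else do
    let small ← Comp.lt r S
    if small then pure r else Comp.sub r S

/-! ### Running straight-line programs on data with costs -/

structure Ops (α : Type) where
  zero : α
  one : α
  add : α → α → Comp α
  sub : α → α → Comp α
  mul : α → α → Comp α

def Instr.exec {α : Type} (o : Ops α) (mem : List α) : Instr → Comp α
  | .one => pure o.one
  | .add i j => o.add (mem.getD i o.zero) (mem.getD j o.zero)
  | .sub i j => o.sub (mem.getD i o.zero) (mem.getD j o.zero)
  | .mul i j => o.mul (mem.getD i o.zero) (mem.getD j o.zero)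

def SLP.exec {α : Type} (o : Ops α) (s : SLP) (inp : List α) : Comp (List α) := do
  let mem ← Comp.fold
    (fun mem c => do
      Comp.tick
      let v ← c.exec o mem
      pure (mem ++ [v])) inp s.code
  pure (s.out.map (fun i => mem.getD i o.zero))

/-- The ring `ℤ / 2 ^ B`, with elements represented in `[0, 2 ^ B)`. -/
def residueOps (I : ℕ → SLP) (B : ℕ) : Ops ℤ where
  zero := 0
  one := 1
  add x y := do
    let z ← Comp.add x y
    Comp.low B z
  sub x y := do
    let z ← Comp.sub x y
    Comp.low B z
  mul x y := do
    let z ← Comp.mul I x y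
    Comp.low B z

def zeroPoly (d : ℕ) : List ℤ := List.replicate d 0

def onePoly (d : ℕ) : List ℤ := 1 :: List.replicate (d - 1) 0

/-- The ring `(ℤ / 2 ^ B)[θ] / θ ^ d`, with elements represented by `d` coefficients. -/
def truncPolyOps (I P : ℕ → SLP) (B d : ℕ) : Ops (List ℤ) where
  zero := zeroPoly d
  one := onePoly d
  add f g := Comp.zip (residueOps I B).add f g
  sub f g := Comp.zip (residueOps I B).sub f g
  mul f g := do
    let h ← (P d).exec (residueOps I B) (f ++ g)
    pure (h.take d)

/-- The representative in `[-2 ^ (B - 1), 2 ^ (B - 1))` of a residue class modulo `2 ^ B`. -/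
def centre (B : ℕ) (x : ℤ) : Comp ℤ := do
  let h ← Comp.shl 1 (B - 1)
  let y ← Comp.add x h
  let z ← Comp.low B y
  Comp.sub z h

/-! ### Matrices over `ℤ[θ] / θ ^ d`: lists of `m * m` lists of `d` integers -/

/-- Product of matrices.  `B` is large enough for the product to be determined by its residue modulo
`2 ^ B`. -/
def matMul (I P A : ℕ → SLP) (m d : ℕ) (X Y : List (List ℤ)) : Comp (List (List ℤ)) := do
  let b ← maxBits (X.flatten ++ Y.flatten)
  let B := 2 * b + m.size + d.size + 2
  let X' ← Comp.map (Comp.map (Comp.low B)) X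
  let Y' ← Comp.map (Comp.map (Comp.low B)) Y
  let Z ← (A m).exec (truncPolyOps I P B d) (X' ++ Y')
  Comp.map (Comp.map (centre B)) Z

/-- Reduction of all coefficients modulo `S`. -/
def matMod (I : ℕ → SLP) (X : List (List ℤ)) (S : ℤ) : Comp (List (List ℤ)) :=
  Comp.map (Comp.map (fun x => intMod I x S)) X

def oneMat (m d : ℕ) : List (List ℤ) :=
  entryList (m := m) (fun i j => if i = j then onePoly d else zeroPoly d)

/-! ### The translation `Q(θ) ↦ Q(θ + a)`, by divide and conquer -/

/-- `(θ + a) ^ (2 ^ t)` modulo `2 ^ B`. -/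
def linearPow (I P : ℕ → SLP) (B : ℕ) (a : ℤ) : ℕ → Comp (List ℤ)
  | 0 => do
    let a' ← Comp.low B a
    pure [a', 1]
  | t + 1 => do
    let q ← linearPow I P B a t
    let r ← (P (2 ^ t + 1)).exec (residueOps I B) (q ++ q)
    pure (r.take (2 ^ (t + 1) + 1))

/-- Translation by `a`, modulo `2 ^ B`, of a polynomial given by `2 ^ t` coefficients. -/
def translateRec (I P : ℕ → SLP) (B : ℕ) (a : ℤ) : ℕ → List ℤ → Comp (List ℤ)
  | 0, Q => pure Q
  | t + 1, Q => do
    let L ← translateRec I P B a t (Q.take (2 ^ t))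
    let H ← translateRec I P B a t (Q.drop (2 ^ t))
    let q ← linearPow I P B a t
    let r ← (P (2 ^ t + 1)).exec (residueOps I B) (q ++ (H ++ [0]))
    Comp.zip (residueOps I B).add (L ++ List.replicate (2 ^ t) 0) (r.take (2 ^ (t + 1)))

/-- Translation by `a ≥ 0` of a polynomial given by `d` coefficients. -/
def translate (I P : ℕ → SLP) (d : ℕ) (a : ℤ) (Q : List ℤ) : Comp (List ℤ) := do
  let b ← maxBits Q
  let a' ← Comp.add a 1
  let c ← Comp.bitSize a'
  let B := b + d.size + d * c + 2
  let t := Nat.clog 2 d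
  let Q' ← Comp.map (Comp.low B) (Q ++ List.replicate (2 ^ t - d) 0)
  let R ← translateRec I P B a t Q'
  Comp.map (centre B) (R.take d)

/-! ### The sieve of Eratosthenes -/

/-- Mark `q + p, q + 2 p, …` as composite, up to `N`. -/
def crossOut (N p : ℕ) : ℕ → ℤ → (ℕ → Bool) → Comp (ℕ → Bool)
  | 0, _, f => pure f
  | k + 1, q, f => do
    let q' ← Comp.add q p
    let done ← Comp.lt N q'
    if done then pure f
    else do
      let f' ← Comp.store f q'.toNat true
      crossOut N p k q' f'

/-- Marks the composite numbers up to `N`. -/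
def sieve (N : ℕ) : Comp (ℕ → Bool) :=
  Comp.fold
    (fun f p => do
      let composite ← Comp.load f p
      if composite then pure f else crossOut N p N p f)
    (fun _ => false) (List.range' 2 (N - 1))

/-! ### The trees and the algorithm -/

inductive Tree (α : Type) where
  | leaf (a : α) : Tree α
  | node (a : α) (l r : Tree α) : Tree α

def Tree.root {α : Type} : Tree α → α
  | .leaf a => a
  | .node a _ _ => a

/-- The product tree of height `h` below the node with index `j` of its level, from the bottom: the
children of the node `(i, j)` are `(i + 1, 2 j)` and `(i + 1, 2 j + 1)`. -/
def productTree {α : Type} (mul : α → α → Comp α) (leaf : ℕ → Comp α) : ℕ → ℕ → Comp (Tree α)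
  | 0, j => do
    let a ← leaf j
    pure (.leaf a)
  | h + 1, j => do
    let l ← productTree mul leaf h (2 * j)
    let r ← productTree mul leaf h (2 * j + 1)
    let a ← mul l.root r.root
    pure (.node a l r)

/-- The element of `{k | j N / 2 ^ η < k ≤ (j + 1) N / 2 ^ η}`, if there is one (where
`N ≤ 2 ^ η`). -/
def leafIndex (I : ℕ → SLP) (N η j : ℕ) : Comp (Option ℤ) := do
  let x ← Comp.mul I j N
  let lo ← Comp.shr x η
  let y ← Comp.add x N
  let hi ← Comp.shr y η
  let nonempty ← Comp.lt lo hi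
  pure (if nonempty then some hi else none)

/-- The leaf `T_{η, j}`: the matrix `M(θ + k)`, or the empty product. -/
def leafT (I P : ℕ → SLP) (m d N η : ℕ) (M : List (List ℤ)) (j : ℕ) : Comp (List (List ℤ)) := do
  let k ← leafIndex I N η j
  match k with
  | none => pure (oneMat m d)
  | some k => Comp.map (translate I P d k) M

/-- The leaf `S_{η, j}`: the prime number `k`, or the empty product. -/
def leafS (I : ℕ → SLP) (N η : ℕ) (composite : ℕ → Bool) (j : ℕ) : Comp ℤ := do
  let k ← leafIndex I N η j
  match k with
  | none => pure 1
  | some k => do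
    let c ← Comp.load composite k.toNat
    pure (if c then 1 else k)

/-- The tree `W`, from the top: `W_{i+1,2j} = W_{i,j} mod S_{i+1,2j}` and
`W_{i+1,2j+1} = W_{i,j} T_{i+1,2j} mod S_{i+1,2j+1}`.  The leaf `W_{η,j}` is stored at the address
`S_{η,j}`. -/
def descend (I P A : ℕ → SLP) (m d : ℕ) : Tree (List (List ℤ)) → Tree ℤ → List (List ℤ) →
    (ℕ → List (List ℤ)) → Comp (ℕ → List (List ℤ))
  | .node _ tl tr, .node _ sl sr, W, mem => do
    let Wl ← matMod I W sl.root
    let Z ← matMul I P A m d W tl.root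
    let Wr ← matMod I Z sr.root
    let mem' ← descend I P A m d tl sl Wl mem
    descend I P A m d tr sr Wr mem'
  | _, s, W, mem => Comp.store mem s.root.toNat W

/-- The algorithm `matrix_factorial`.  `I`, `P`, `A` are the subroutines for the multiplication of
integers, polynomials and matrices, `M` is an `m × m` matrix of polynomials with `d` coefficients,
and `primes` is a list of primes less than `N`. -/
def matrixFactorial (I P A : ℕ → SLP) (m d N : ℕ) (M : List (List ℤ)) (primes : List ℕ) :
    Comp (List (List (List ℤ))) := do
  let η := Nat.clog 2 N
  let composite ← sieve N
  let T ← productTree (matMul I P A m d) (leafT I P m d N η M) η 0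
  let S ← productTree (Comp.mul I) (leafS I N η composite) η 0
  let W ← descend I P A m d T S (oneMat m d) (fun _ => [])
  Comp.map
    (fun p => do
      let w ← Comp.load W p
      let z ← matMul I P A m d M w
      matMod I z p) primes

/-! ### What the algorithm computes -/

/-- The matrix `M(θ) M(θ + 1) ⋯ M(θ + p - 1)`. -/
noncomputable def matFactorial {m : ℕ} (M : Matrix (Fin m) (Fin m) ℤ[X]) (p : ℕ) :
    Matrix (Fin m) (Fin m) ℤ[X] :=
  ((List.range p).map (fun k => M.map (fun Q => Q.comp (X + C (k : ℤ))))).prod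

/-- The input format: the coefficients of `θ ^ 0, …, θ ^ (d - 1)` of every entry. -/
noncomputable def encode {m : ℕ} (d : ℕ) (M : Matrix (Fin m) (Fin m) ℤ[X]) : List (List ℤ) :=
  entryList (M.map (coeffList d))

/-- The reduction of a matrix modulo `(p, θ ^ d)`, with coefficients in `[0, p)`. -/
noncomputable def encodeMod {m : ℕ} (p d : ℕ) (M : Matrix (Fin m) (Fin m) ℤ[X]) :
    List (List ℤ) :=
  entryList (M.map (fun Q => (coeffList d Q).map (fun c => c % (p : ℤ))))

/-- The quantity `m ^ ω d N (n + d log N + log m)`. -/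
noncomputable def costScale (ω : ℝ) (m d n N : ℕ) : ℝ :=
  (m : ℝ) ^ ω * d * N * (n + d * Real.log N + Real.log m)

end RemainderTree

/-! Put b(x) = ⌊xN/2^η⌋. Since N ≤ 2^η, consecutive values of b differ by at most one, so the node j
at height h above the leaves stands for the interval (b(j·2^h), b((j+1)·2^h)], and each leaf for at
most one integer. Over this interval, T holds the product of the M(θ + k) and S the product of the
primes.

Correctness rests on one invariant of the descent (`Setup.descend_spec`): at a node whose interval
begins after a, W ≡ M(θ + 1)⋯M(θ + a) modulo (S, θ^d). It passes to the left child because the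
child's S divides S, and to the right child after multiplication by T of the left child. At the leaf
of a prime p it gives M(θ + 1)⋯M(θ + p − 1) modulo p, and the missing factor M(θ) is put in front at
the end (`matFactorial_eq`).

For the cost, let β bound the bit sizes at the leaves, with a reserve for the growth in one matrix
product. Bit sizes add under multiplication and W is kept reduced modulo S, so all integers at
height h have O(2^h β) bits. There are 2^(η−h) nodes at that height and the arithmetic is
quasi-linear, hence every level costs about 2^η β, up to the matrix and polynomial factors and
logarithms, and there are only η levels (`productTree_spec`, `Setup.descend_spec`,
`Setup.matrixFactorial_spec`). Every logarithm is at most a constant times 1 + log X, which yields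
the final bound (`cost_product_le`).

The subroutines enter through a simulation argument (`Ops.Implements.slp`): a program run on
residues modulo 2^B mirrors its run over ℤ or ℤ[X], and the exact result is recovered because B
exceeds its bit size. Polynomials stay in ℤ[X] throughout and are compared only in their
coefficients below θ^d; this is compatible with the ring operations, so no quotient ring is needed.
Division is justified by the error identity in `newton_step`, translation by splitting a polynomial
in halves, the sieve by induction on the loop index. -/

namespace RemainderTree

/-! ### Values and costs of composite computations -/

namespace Comp

variable {α β γ : Type}

@[simp] theorem val_bind (x : Comp α) (f : α → Comp β) : (x >>= f).val = (f x.val).val := rfl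

@[simp] theorem cost_bind (x : Comp α) (f : α → Comp β) :
    (x >>= f).cost = x.cost + (f x.val).cost := rfl

@[simp] theorem val_pure (a : α) : (pure a : Comp α).val = a := rfl

@[simp] theorem cost_pure (a : α) : (pure a : Comp α).cost = 0 := rfl

@[simp] theorem cost_tick : tick.cost = 1 := rfl
@[simp] theorem val_add (x y : ℤ) : (add x y).val = x + y := rfl
@[simp] theorem cost_add (x y : ℤ) : (add x y).cost = bits x + bits y + 1 := rfl
@[simp] theorem val_sub (x y : ℤ) : (sub x y).val = x - y := rfl
@[simp] theorem cost_sub (x y : ℤ) : (sub x y).cost = bits x + bits y + 1 := rfl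
@[simp] theorem val_lt (x y : ℤ) : (lt x y).val = decide (x < y) := rfl
@[simp] theorem cost_lt (x y : ℤ) : (lt x y).cost = bits x + bits y + 1 := rfl
@[simp] theorem val_bitSize (x : ℤ) : (bitSize x).val = bits x := rfl
@[simp] theorem cost_bitSize (x : ℤ) : (bitSize x).cost = bits x + 1 := rfl
@[simp] theorem val_shl (x : ℤ) (k : ℕ) : (shl x k).val = x * 2 ^ k := rfl
@[simp] theorem cost_shl (x : ℤ) (k : ℕ) : (shl x k).cost = bits x + k + 1 := rfl
@[simp] theorem val_shr (x : ℤ) (k : ℕ) : (shr x k).val = x / 2 ^ k := rfl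
@[simp] theorem cost_shr (x : ℤ) (k : ℕ) : (shr x k).cost = bits x + k + 1 := rfl
@[simp] theorem val_low (k : ℕ) (x : ℤ) : (low k x).val = x % 2 ^ k := rfl
@[simp] theorem cost_low (k : ℕ) (x : ℤ) : (low k x).cost = bits x + k + 1 := rfl
@[simp] theorem val_mul (I : ℕ → SLP) (x y : ℤ) : (mul I x y).val = x * y := rfl
@[simp] theorem cost_mul (I : ℕ → SLP) (x y : ℤ) :
    (mul I x y).cost = (I (max (bits x) (bits y))).length + bits x + bits y + 1 := rfl
@[simp] theorem val_load (f : ℕ → α) (i : ℕ) : (load f i).val = f i := rfl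
@[simp] theorem cost_load (f : ℕ → α) (i : ℕ) : (load f i).cost = 1 := rfl
@[simp] theorem val_store (f : ℕ → α) (i : ℕ) (a : α) :
    (store f i a).val = Function.update f i a := rfl
@[simp] theorem cost_store (f : ℕ → α) (i : ℕ) (a : α) : (store f i a).cost = 1 := rfl

@[simp] theorem val_map (f : α → Comp β) (l : List α) :
    (map f l).val = l.map (fun a => (f a).val) := by
  induction l with
  | nil => rfl
  | cons a l ih => simp [map, ih]

theorem cost_map_le (f : α → Comp β) (l : List α) (c : ℕ) (h : ∀ a ∈ l, (f a).cost ≤ c) :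
    (map f l).cost ≤ l.length * c := by
  induction l with
  | nil => simp [map]
  | cons a l ih =>
    have h1 := h a (by simp)
    have h2 := ih (fun b hb => h b (by simp [hb]))
    simp only [map, cost_bind, cost_pure, List.length_cons]
    linarith

@[simp] theorem val_zip (f : α → β → Comp γ) (l : List α) (l' : List β) :
    (zip f l l').val = List.zipWith (fun a b => (f a b).val) l l' := by
  induction l generalizing l' with
  | nil => simp [zip]
  | cons a l ih =>
    cases l' with
    | nil => simp [zip]
    | cons b l' => simp [zip, ih]

theorem cost_zip_le (f : α → β → Comp γ) (l : List α) (l' : List β) (c : ℕ)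
    (h : ∀ a ∈ l, ∀ b ∈ l', (f a b).cost ≤ c) : (zip f l l').cost ≤ l.length * c := by
  induction l generalizing l' with
  | nil => simp [zip]
  | cons a l ih =>
    cases l' with
    | nil => simp [zip]
    | cons b l' =>
      have h1 := h a (by simp) b (by simp)
      have h2 := ih l' (fun x hx y hy => h x (by simp [hx]) y (by simp [hy]))
      simp only [zip, cost_bind, cost_pure, List.length_cons]
      linarith

theorem fold_append (f : β → α → Comp β) (b : β) (l l' : List α) :
    (fold f b (l ++ l')).val = (fold f (fold f b l).val l').val ∧
    (fold f b (l ++ l')).cost = (fold f b l).cost + (fold f (fold f b l).val l').cost := by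
  induction l generalizing b with
  | nil => simp [fold]
  | cons a l ih =>
    simp only [List.cons_append, fold, val_bind, cost_bind, ih, true_and]
    ring

end Comp

/-! ### Bit sizes -/

theorem bits_le_iff {x : ℤ} {b : ℕ} : bits x ≤ b ↔ |x| < 2 ^ b := by
  rw [bits, Nat.size_le, ← Int.natCast_natAbs]
  exact_mod_cast Iff.rfl

theorem abs_lt_two_pow_bits (x : ℤ) : |x| < 2 ^ bits x := bits_le_iff.1 le_rfl

theorem bits_le_of_abs_le {x y : ℤ} (h : |x| ≤ |y|) : bits x ≤ bits y :=
  bits_le_iff.2 (h.trans_lt (abs_lt_two_pow_bits y))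

@[simp] theorem bits_zero : bits 0 = 0 := by simp [bits]

@[simp] theorem bits_one : bits 1 = 1 := by simp [bits]

theorem bits_natCast (n : ℕ) : bits n = n.size := by simp [bits]

theorem bits_mul_le (x y : ℤ) : bits (x * y) ≤ bits x + bits y := by
  rw [bits_le_iff, abs_mul, pow_add]
  exact mul_lt_mul'' (abs_lt_two_pow_bits x) (abs_lt_two_pow_bits y) (abs_nonneg _) (abs_nonneg _)

theorem bits_add_le {x y : ℤ} {b : ℕ} (hx : bits x ≤ b) (hy : bits y ≤ b) :
    bits (x + y) ≤ b + 1 := by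
  rw [bits_le_iff] at *
  have := abs_add_le x y
  rw [pow_succ]
  linarith

theorem bits_sub_le {x y : ℤ} {b : ℕ} (hx : bits x ≤ b) (hy : bits y ≤ b) :
    bits (x - y) ≤ b + 1 := by
  rw [bits_le_iff] at *
  have := abs_sub x y
  rw [pow_succ]
  linarith

theorem bits_emod_two_pow (x : ℤ) (b : ℕ) : bits (x % 2 ^ b) ≤ b := by
  rw [bits_le_iff, abs_of_nonneg (Int.emod_nonneg _ (by positivity))]
  exact Int.emod_lt_of_pos _ (by positivity)

theorem bits_two_pow (k : ℕ) : bits (2 ^ k) = k + 1 := by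
  have : (2 : ℤ) ^ k = ((2 ^ k : ℕ) : ℤ) := by push_cast; rfl
  rw [this, bits_natCast, Nat.size_pow]

theorem bits_emod_le (x : ℤ) {S : ℤ} (hS : 0 < S) : bits (x % S) ≤ bits S := by
  apply bits_le_of_abs_le
  rw [abs_of_nonneg (Int.emod_nonneg _ hS.ne'), abs_of_pos hS]
  exact (Int.emod_lt_of_pos _ hS).le

theorem bits_shr_le (x : ℤ) (k : ℕ) : bits (x / 2 ^ k) ≤ bits x := by
  apply bits_le_of_abs_le
  exact Int.abs_ediv_le_abs _ _

/-! ### A common bound for the primitives on integers of bounded bit size -/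

/-- Up to a constant factor, a bound for the cost of one primitive operation on integers of bit size
at most `b`. -/
def arithCost (I : ℕ → SLP) (b : ℕ) : ℕ :=
  (Finset.range (b + 1)).sup (fun i => (I i).length) + b + 1

/-- The supremum in `arithCost` serves this purpose: the lengths of the circuits `I i` are not
assumed to increase with `i`. -/
theorem arithCost_mono (I : ℕ → SLP) {b c : ℕ} (h : b ≤ c) : arithCost I b ≤ arithCost I c := by
  have : (Finset.range (b + 1)).sup (fun i => (I i).length) ≤
      (Finset.range (c + 1)).sup (fun i => (I i).length) :=
    Finset.sup_mono (by intro x; simp; omega)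
  unfold arithCost
  omega

theorem succ_le_arithCost (I : ℕ → SLP) (b : ℕ) : b + 1 ≤ arithCost I b := by
  unfold arithCost; omega

theorem length_add_le_arithCost (I : ℕ → SLP) {a b : ℕ} (h : a ≤ b) :
    (I a).length + b + 1 ≤ arithCost I b := by
  have : (I a).length ≤ (Finset.range (b + 1)).sup (fun i => (I i).length) :=
    Finset.le_sup (f := fun i => (I i).length) (by simp; omega)
  unfold arithCost
  omega

theorem cost_mul_le (I : ℕ → SLP) {x y : ℤ} {b : ℕ} (hx : bits x ≤ b) (hy : bits y ≤ b) :
    (Comp.mul I x y).cost ≤ 2 * arithCost I b := by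
  have h1 := length_add_le_arithCost I (max_le hx hy)
  have h2 := succ_le_arithCost I b
  simp only [Comp.cost_mul]
  omega

theorem val_maxBits_cons (x : ℤ) (l : List ℤ) :
    (maxBits (x :: l)).val = max (bits x) (maxBits l).val := by simp [maxBits]

theorem bits_le_maxBits {l : List ℤ} {x : ℤ} (h : x ∈ l) : bits x ≤ (maxBits l).val := by
  induction l with
  | nil => simp at h
  | cons y l ih =>
    rw [val_maxBits_cons]
    rcases List.mem_cons.1 h with rfl | h
    · exact le_max_left _ _
    · exact (ih h).trans (le_max_right _ _)

theorem maxBits_le {l : List ℤ} {b : ℕ} (h : ∀ x ∈ l, bits x ≤ b) : (maxBits l).val ≤ b := by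
  induction l with
  | nil => simp [maxBits]
  | cons y l ih =>
    rw [val_maxBits_cons]
    exact max_le (h y (by simp)) (ih fun x hx => h x (by simp [hx]))

theorem cost_maxBits_le {l : List ℤ} {b : ℕ} (h : ∀ x ∈ l, bits x ≤ b) :
    (maxBits l).cost ≤ l.length * (b + 1) := by
  induction l with
  | nil => simp [maxBits]
  | cons y l ih =>
    have h1 := h y (by simp)
    have h2 := ih fun x hx => h x (by simp [hx])
    simp only [maxBits, Comp.cost_bind, Comp.cost_bitSize, Comp.cost_pure, List.length_cons]
    linarith

/-! ### Straight-line programs on represented data -/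

theorem forall₂_getD {α β : Type} {r : α → β → Prop} {l : List α} {l' : List β}
    (h : List.Forall₂ r l l') {a : α} {b : β} (hab : r a b) (i : ℕ) :
    r (l.getD i a) (l'.getD i b) := by
  induction h generalizing i with
  | nil => simpa using hab
  | cons h _ ih => cases i with
    | zero => simpa using h
    | succ i => simpa using ih i

/-- `o` implements the operations of the ring `R` on representatives, at cost at most `c` each. -/
structure Ops.Implements {α R : Type} [Ring R] (o : Ops α) (r : α → R → Prop) (c : ℕ) : Prop where
  zero : r o.zero 0
  one : r o.one 1
  add : ∀ {a b x y}, r a x → r b y → r (o.add a b).val (x + y) ∧ (o.add a b).cost ≤ c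
  sub : ∀ {a b x y}, r a x → r b y → r (o.sub a b).val (x - y) ∧ (o.sub a b).cost ≤ c
  mul : ∀ {a b x y}, r a x → r b y → r (o.mul a b).val (x * y) ∧ (o.mul a b).cost ≤ c

theorem Ops.Implements.instr {α R : Type} [Ring R] {o : Ops α} {r : α → R → Prop} {c : ℕ}
    (ho : o.Implements r c) {mem : List α} {mem' : List R} (h : List.Forall₂ r mem mem')
    (i : Instr) : r (i.exec o mem).val (i.eval mem') ∧ (i.exec o mem).cost ≤ c := by
  have hg := forall₂_getD h ho.zero
  cases i with
  | one => exact ⟨ho.one, Nat.zero_le _⟩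
  | add i j => exact ho.add (hg i) (hg j)
  | sub i j => exact ho.sub (hg i) (hg j)
  | mul i j => exact ho.mul (hg i) (hg j)

/-- Simulation: the relation between representatives and ring elements holds for the inputs and the
default value, and every instruction preserves it. The summand 1 in the cost is the instruction
fetch. -/
theorem Ops.Implements.slp {α R : Type} [Ring R] {o : Ops α} {r : α → R → Prop} {c : ℕ}
    (ho : o.Implements r c) (s : SLP) {inp : List α} {inp' : List R}
    (h : List.Forall₂ r inp inp') :
    List.Forall₂ r (s.exec o inp).val (s.eval inp') ∧ (s.exec o inp).cost ≤ s.length * (c + 1) := by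
  have key : ∀ (code : List Instr) (mem : List α) (mem' : List R), List.Forall₂ r mem mem' →
      List.Forall₂ r (Comp.fold (fun mem c => do
        Comp.tick
        let v ← c.exec o mem
        pure (mem ++ [v])) mem code).val (code.foldl (fun mem c => mem ++ [c.eval mem]) mem') ∧
      (Comp.fold (fun mem c => do
        Comp.tick
        let v ← c.exec o mem
        pure (mem ++ [v])) mem code).cost ≤ code.length * (c + 1) := by
    intro code
    induction code with
    | nil => intro mem mem' h; simpa [Comp.fold] using h
    | cons i code ih =>
      intro mem mem' h
      obtain ⟨h1, h2⟩ := ho.instr h i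
      obtain ⟨h3, h4⟩ := ih (mem ++ [(i.exec o mem).val]) (mem' ++ [i.eval mem'])
        (List.rel_append h (by simpa using h1))
      refine ⟨by simpa [Comp.fold] using h3, ?_⟩
      simp only [Comp.fold, Comp.cost_bind, Comp.cost_tick, Comp.cost_pure, Comp.val_bind,
        Comp.val_pure, List.length_cons]
      linarith
  obtain ⟨h1, h2⟩ := key s.code inp inp' h
  refine ⟨?_, by simpa [SLP.exec, SLP.length] using h2⟩
  simp only [SLP.exec, Comp.val_bind, Comp.val_pure, SLP.eval]
  rw [List.forall₂_map_left_iff, List.forall₂_map_right_iff, List.forall₂_same]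
  exact fun i _ => forall₂_getD h1 ho.zero i

theorem forall₂_eq_map {α β : Type} {f : β → α} {l : List α} {l' : List β} :
    List.Forall₂ (fun a b => a = f b) l l' ↔ l = l'.map f := by
  rw [← List.forall₂_eq_eq_eq, List.forall₂_map_right_iff]

theorem residueOps_implements (I : ℕ → SLP) {B : ℕ} (hB : 1 ≤ B) :
    (residueOps I B).Implements (fun x a : ℤ => x = a % 2 ^ B) (5 * arithCost I B) := by
  have hs := succ_le_arithCost I B
  constructor
  · simp [residueOps]
  · have : (1 : ℤ) < 2 ^ B := one_lt_pow₀ (by norm_num) (by omega)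
    exact (Int.emod_eq_of_lt (by norm_num) this).symm
  · rintro _ _ x y rfl rfl
    have hx := bits_emod_two_pow x B
    have hy := bits_emod_two_pow y B
    have := bits_add_le hx hy
    refine ⟨by simp [residueOps], ?_⟩
    simp only [residueOps, Comp.cost_bind, Comp.cost_add, Comp.cost_low, Comp.val_add]
    omega
  · rintro _ _ x y rfl rfl
    have hx := bits_emod_two_pow x B
    have hy := bits_emod_two_pow y B
    have := bits_sub_le hx hy
    refine ⟨by simp [residueOps, Int.sub_emod], ?_⟩
    simp only [residueOps, Comp.cost_bind, Comp.cost_sub, Comp.cost_low, Comp.val_sub]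
    omega
  · rintro _ _ x y rfl rfl
    have hx := bits_emod_two_pow x B
    have hy := bits_emod_two_pow y B
    have h1 := bits_mul_le (x % 2 ^ B) (y % 2 ^ B)
    have h2 := cost_mul_le I hx hy
    refine ⟨by simp [residueOps, Int.mul_emod], ?_⟩
    simp only [residueOps, Comp.cost_bind, Comp.cost_low, Comp.val_mul]
    omega

/-- Running a program modulo `2 ^ B` yields the residues of its outputs over `ℤ`. -/
theorem exec_residueOps (I : ℕ → SLP) {B : ℕ} (hB : 1 ≤ B) (s : SLP) (l : List ℤ) :
    (s.exec (residueOps I B) (l.map (· % 2 ^ B))).val = (s.eval l).map (· % 2 ^ B) ∧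
    (s.exec (residueOps I B) (l.map (· % 2 ^ B))).cost ≤ s.length * (6 * arithCost I B) := by
  obtain ⟨h1, h2⟩ := (residueOps_implements I hB).slp s
    (forall₂_eq_map (f := fun a : ℤ => a % 2 ^ B).2 (rfl : l.map (· % 2 ^ B) = _))
  refine ⟨forall₂_eq_map.1 h1, h2.trans (Nat.mul_le_mul_left _ ?_)⟩
  have := succ_le_arithCost I B
  omega

/-! ### Coefficient lists -/

@[simp] theorem length_coeffList {R : Type} [Semiring R] (d : ℕ) (f : R[X]) :
    (coeffList d f).length = d := by simp [coeffList]

theorem coeffList_congr {R : Type} [Semiring R] {d : ℕ} {f g : R[X]}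
    (h : ∀ i < d, f.coeff i = g.coeff i) : coeffList d f = coeffList d g :=
  List.map_congr_left fun i hi => h i (List.mem_range.1 hi)

theorem take_coeffList {R : Type} [Semiring R] {d e : ℕ} (h : d ≤ e) (f : R[X]) :
    (coeffList e f).take d = coeffList d f := by
  rw [coeffList, ← List.map_take, List.take_range, min_eq_left h, coeffList]

theorem coeffList_add {R : Type} [Semiring R] (d e : ℕ) (f : R[X]) :
    coeffList (d + e) f = coeffList d f ++ (List.range e).map (fun i => f.coeff (d + i)) := by
  simp [coeffList, List.range_add, Function.comp_def]

/-- The residue of a polynomial modulo `θ ^ d`. -/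
noncomputable def truncPoly (d : ℕ) (f : ℤ[X]) : ℤ[X] :=
  ∑ i ∈ Finset.range d, monomial i (f.coeff i)

theorem coeff_truncPoly (d : ℕ) (f : ℤ[X]) (i : ℕ) :
    (truncPoly d f).coeff i = if i < d then f.coeff i else 0 := by
  simp [truncPoly, coeff_monomial]

theorem degree_truncPoly_lt (d : ℕ) (f : ℤ[X]) : (truncPoly d f).degree < d := by
  rw [degree_lt_iff_coeff_zero]
  intro i hi
  rw [coeff_truncPoly, if_neg (by exact_mod_cast hi.not_gt)]

theorem coeff_mul_congr {R : Type} [Semiring R] {f f' g g' : R[X]} {i : ℕ}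
    (hf : ∀ j ≤ i, f.coeff j = f'.coeff j) (hg : ∀ j ≤ i, g.coeff j = g'.coeff j) :
    (f * g).coeff i = (f' * g').coeff i := by
  rw [coeff_mul, coeff_mul]
  refine Finset.sum_congr rfl fun x hx => ?_
  rw [Finset.HasAntidiagonal.mem_antidiagonal] at hx
  rw [hf _ (by omega), hg _ (by omega)]

theorem coeffList_truncPoly (d : ℕ) (f : ℤ[X]) : coeffList d (truncPoly d f) = coeffList d f :=
  coeffList_congr fun i hi => by rw [coeff_truncPoly, if_pos hi]

/-- Product of polynomials of degree less than `d`, modulo `2 ^ B`. -/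
theorem exec_polyMul (I : ℕ → SLP) {B d : ℕ} (hB : 1 ≤ B) {s : SLP} (hs : MultipliesPolynomials d s)
    {f g : ℤ[X]} (hf : f.degree < d) (hg : g.degree < d) :
    (s.exec (residueOps I B)
      ((coeffList d f).map (· % 2 ^ B) ++ (coeffList d g).map (· % 2 ^ B))).val =
      (coeffList (2 * d) (f * g)).map (· % 2 ^ B) ∧
    (s.exec (residueOps I B)
      ((coeffList d f).map (· % 2 ^ B) ++ (coeffList d g).map (· % 2 ^ B))).cost ≤
      s.length * (6 * arithCost I B) := by
  rw [← List.map_append, ← hs ℤ f g hf hg]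
  exact exec_residueOps I hB s _

theorem coeffList_zipWith {d B : ℕ} {f g h : ℤ[X]} {op : ℤ → ℤ → ℤ}
    (H : ∀ i < d, op (f.coeff i % 2 ^ B) (g.coeff i % 2 ^ B) = h.coeff i % 2 ^ B) :
    List.zipWith op ((coeffList d f).map (· % 2 ^ B)) ((coeffList d g).map (· % 2 ^ B)) =
      (coeffList d h).map (· % 2 ^ B) := by
  simp only [coeffList, List.map_map, List.zipWith_map, List.zipWith_self]
  exact List.map_congr_left fun i hi => H i (List.mem_range.1 hi)

/-- A list may represent any polynomial with these low coefficients, not only one of degree below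
`d`. The represented ring is therefore ℤ[X] itself, over which the correctness of the matrix program
can be invoked. -/
theorem truncPolyOps_implements (I P : ℕ → SLP) {B d : ℕ} (hB : 1 ≤ B) (hd : 1 ≤ d)
    (hP : MultipliesPolynomials d (P d)) :
    (truncPolyOps I P B d).Implements
      (fun l (f : ℤ[X]) => l = (coeffList d f).map (· % 2 ^ B))
      (((P d).length + d) * (6 * arithCost I B)) := by
  have ho := residueOps_implements I hB
  have hmem : ∀ {f : ℤ[X]} {x : ℤ}, x ∈ (coeffList d f).map (· % 2 ^ B) → ∃ a, x = a % 2 ^ B := by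
    intro f x hx
    obtain ⟨a, -, rfl⟩ := List.mem_map.1 hx
    exact ⟨a, rfl⟩
  have hle : d * (5 * arithCost I B) ≤ ((P d).length + d) * (6 * arithCost I B) :=
    Nat.mul_le_mul (by omega) (by omega)
  constructor
  · simp [truncPolyOps, zeroPoly, coeffList, Function.comp_def]
  · obtain ⟨e, rfl⟩ : ∃ e, d = e + 1 := ⟨d - 1, by omega⟩
    have h1 : (1 : ℤ) % 2 ^ B = 1 := (ho.one).symm
    simp [truncPolyOps, onePoly, coeffList, Function.comp_def,
      List.range_succ_eq_map, coeff_one, h1]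
  · rintro _ _ f g rfl rfl
    constructor
    · simp only [truncPolyOps, Comp.val_zip]
      exact coeffList_zipWith fun i _ => by rw [(ho.add rfl rfl).1, coeff_add]
    · refine (Comp.cost_zip_le _ _ _ (5 * arithCost I B) ?_).trans (by simpa using hle)
      intro a ha b hb
      obtain ⟨x, rfl⟩ := hmem ha
      obtain ⟨y, rfl⟩ := hmem hb
      exact (ho.add rfl rfl).2
  · rintro _ _ f g rfl rfl
    constructor
    · simp only [truncPolyOps, Comp.val_zip]
      exact coeffList_zipWith fun i _ => by rw [(ho.sub rfl rfl).1, coeff_sub]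
    · refine (Comp.cost_zip_le _ _ _ (5 * arithCost I B) ?_).trans (by simpa using hle)
      intro a ha b hb
      obtain ⟨x, rfl⟩ := hmem ha
      obtain ⟨y, rfl⟩ := hmem hb
      exact (ho.sub rfl rfl).2
  · rintro _ _ f g rfl rfl
    -- `P d` is only correct in degree below `d`, so it is applied to the truncations; these have
    -- the same product modulo θ^d.
    obtain ⟨h1, h2⟩ := exec_polyMul I hB hP (degree_truncPoly_lt d f) (degree_truncPoly_lt d g)
    rw [coeffList_truncPoly, coeffList_truncPoly] at h1 h2
    simp only [truncPolyOps, Comp.val_bind, Comp.cost_bind, Comp.val_pure, Comp.cost_pure]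
    refine ⟨?_, h2.trans (Nat.mul_le_mul_right _ (by omega))⟩
    rw [h1, ← List.map_take, take_coeffList (by omega)]
    congr 1
    refine coeffList_congr fun i hi => coeff_mul_congr ?_ ?_ <;>
    · intro j hj
      rw [coeff_truncPoly, if_pos (by omega)]

/-! ### Division with remainder -/

theorem val_reciprocal_succ (I : ℕ → SLP) (S : ℤ) (s t : ℕ) :
    (reciprocal I S s (t + 1)).val = (reciprocal I S s t).val * 2 ^ (2 ^ t + 1) -
      S * ((reciprocal I S s t).val * (reciprocal I S s t).val) / 2 ^ s := rfl

/-- With e = vS − TK, the new error multiplied by T equals S(Sv² − uT) − e². The first term lies in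
[0, ST) because of the rounding in u, the second in [0, S²], and S² ≤ ST; so the error bound S
reproduces itself while K is squared. -/
theorem newton_step {S K T v u : ℤ} (hS : 0 < S) (hST : S ≤ T) (hv : |v * S - T * K| ≤ S)
    (hu : u = S * (v * v) / T) : |(v * (2 * K) - u) * S - T * (K * K)| ≤ S := by
  have hT : 0 < T := hS.trans_le hST
  have h1 : u * T ≤ S * (v * v) := hu ▸ Int.ediv_mul_le _ hT.ne'
  have h2 : S * (v * v) < (u + 1) * T := by
    rw [hu]; exact Int.lt_ediv_add_one_mul_self _ hT
  set e := v * S - T * K with he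
  have he2 : e * e ≤ S * S := by
    rw [← abs_mul_abs_self e]; exact mul_self_le_mul_self (abs_nonneg _) hv
  have hSS : S * S ≤ S * T := mul_le_mul_of_nonneg_left hST hS.le
  have key : T * ((v * (2 * K) - u) * S - T * (K * K)) =
      S * (S * (v * v) - u * T) - e * e := by rw [he]; ring
  have h3 : S * (S * (v * v) - u * T) ≤ S * T :=
    mul_le_mul_of_nonneg_left (by linarith) hS.le
  have h4 : 0 ≤ S * (S * (v * v) - u * T) := mul_nonneg hS.le (by linarith)
  rw [abs_le]
  constructor
  · refine le_of_mul_le_mul_left ?_ hT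
    rw [key]
    nlinarith
  · refine le_of_mul_le_mul_left ?_ hT
    rw [key]
    nlinarith [mul_self_nonneg e]

theorem two_pow_bits_le {S : ℤ} (hS : 0 < S) : 2 ^ bits S ≤ 2 * S := by
  by_contra! h
  have h1 : 0 < bits S := by
    by_contra! h0
    have := bits_le_iff.1 h0
    rw [abs_of_pos hS] at this
    norm_num at this
    omega
  obtain ⟨k, hk⟩ : ∃ k, bits S = k + 1 := ⟨bits S - 1, by omega⟩
  have : bits S ≤ k := bits_le_iff.2 (by
    rw [abs_of_pos hS]
    rw [hk, pow_succ] at h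
    linarith)
  omega

theorem lt_two_pow_bits {S : ℤ} (hS : 0 < S) : S < 2 ^ bits S := by
  simpa [abs_of_pos hS] using abs_lt_two_pow_bits S

/-- The error of the approximate reciprocal is at most one. -/
theorem reciprocal_spec (I : ℕ → SLP) {S : ℤ} (hS : 0 < S) (t : ℕ) :
    |(reciprocal I S (bits S) t).val * S - 2 ^ bits S * 2 ^ 2 ^ t| ≤ S := by
  have h1 := two_pow_bits_le hS
  have h2 := lt_two_pow_bits hS
  induction t with
  | zero =>
    -- For s = `bits S`, the start value 3 works because S < 2^s ≤ 2S puts 3S − 2·2^s between −S and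
    -- S.
    have : (reciprocal I S (bits S) 0).val = 3 := rfl
    rw [this, abs_le]
    constructor <;> norm_num <;> linarith
  | succ t ih =>
    rw [val_reciprocal_succ]
    have e1 : (2 : ℤ) ^ 2 ^ (t + 1) = 2 ^ 2 ^ t * 2 ^ 2 ^ t := by rw [← pow_add]; ring
    have e2 : (2 : ℤ) ^ (2 ^ t + 1) = 2 * 2 ^ 2 ^ t := by ring
    rw [e1, e2]
    exact newton_step hS h2.le ih rfl

theorem reciprocal_nonneg (I : ℕ → SLP) {S : ℤ} (hS : 0 < S) (t : ℕ) :
    0 ≤ (reciprocal I S (bits S) t).val := by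
  have h := (abs_le.1 (reciprocal_spec I hS t)).1
  have h2 := lt_two_pow_bits hS
  have h3 : (1 : ℤ) ≤ 2 ^ 2 ^ t := one_le_pow₀ (by norm_num)
  by_contra! h0
  nlinarith

theorem bits_reciprocal_le (I : ℕ → SLP) {S : ℤ} (hS : 0 < S) (t : ℕ) :
    bits (reciprocal I S (bits S) t).val ≤ 2 ^ t + 2 := by
  have h := (abs_le.1 (reciprocal_spec I hS t)).2
  have h1 := two_pow_bits_le hS
  have h3 : (1 : ℤ) ≤ 2 ^ 2 ^ t := one_le_pow₀ (by norm_num)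
  have h4 : (reciprocal I S (bits S) t).val ≤ 2 * 2 ^ 2 ^ t + 1 := by
    by_contra! h0
    nlinarith
  rw [bits_le_iff, abs_of_nonneg (reciprocal_nonneg I hS t), pow_add]
  linarith

/-- Every step is charged at the full precision `b`. The loss against the geometric sum is a factor
`t`, which the logarithmic factors of the final bound absorb. -/
theorem cost_reciprocal_le (I : ℕ → SLP) {S : ℤ} (hS : 0 < S) (t b : ℕ)
    (hb : 3 * 2 ^ t + bits S + 6 ≤ b) :
    (reciprocal I S (bits S) t).cost ≤ t * (8 * arithCost I b) := by
  induction t with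
  | zero => simp [reciprocal]
  | succ t ih =>
    rw [pow_succ] at hb
    have h0 := ih (by omega)
    have hv := bits_reciprocal_le I hS t
    set v := (reciprocal I S (bits S) t).val with hvdef
    have hs := succ_le_arithCost I b
    have h1 : bits (v * 2 ^ (2 ^ t + 1)) ≤ (2 ^ t + 2) + (2 ^ t + 2) := by
      refine (bits_mul_le _ _).trans ?_
      rw [bits_two_pow]
      omega
    have h2 : bits (v * v) ≤ (2 ^ t + 2) + (2 ^ t + 2) := (bits_mul_le _ _).trans (by omega)
    have h3 : bits (S * (v * v)) ≤ bits S + ((2 ^ t + 2) + (2 ^ t + 2)) :=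
      (bits_mul_le _ _).trans (by omega)
    have h4 := bits_shr_le (S * (v * v)) (bits S)
    have h5 := cost_mul_le I (x := v) (y := v) (b := b) (by omega) (by omega)
    have h6 := cost_mul_le I (x := S) (y := v * v) (b := b) (by omega) (by omega)
    simp only [reciprocal, Comp.cost_bind, ← hvdef, Comp.val_shl, Comp.val_mul, Comp.val_shr,
      Comp.cost_shl, Comp.cost_shr, Comp.cost_sub]
    have h7 : bits (S * (v * v) / 2 ^ bits S) ≤ b := by omega
    have e : (t + 1) * (8 * arithCost I b) = t * (8 * arithCost I b) + 8 * arithCost I b := by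
      ring
    rw [e]
    omega

/-- The corrected quotient of `intMod` differs from the true one by at most one. -/
theorem approx_quotient {x S v D r : ℤ} (hS : 0 < S) (hD : 0 < D) (hv : |v * S - D| ≤ S)
    (hx : 2 * |x| ≤ D) (hr : r = x - x * v / D * S) : -S ≤ r ∧ r < 2 * S := by
  have h1 : x * v / D * D ≤ x * v := Int.ediv_mul_le _ hD.ne'
  have h2 : x * v < (x * v / D + 1) * D := Int.lt_ediv_add_one_mul_self _ hD
  set q := x * v / D
  have h3 : |x * (v * S - D)| ≤ |x| * S := by
    rw [abs_mul]; exact mul_le_mul_of_nonneg_left hv (abs_nonneg x)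
  obtain ⟨h4, h5⟩ := abs_le.1 h3
  have h6 : 2 * |x| * S ≤ D * S := mul_le_mul_of_nonneg_right hx hS.le
  have h7 := mul_le_mul_of_nonneg_right h1 hS.le
  have h8 := mul_lt_mul_of_pos_right h2 hS
  have hDS := mul_pos hD hS
  -- The right side is x(D − vS) + (xv − qD)S. The first term is at most DS/2 in absolute value, the
  -- second lies in [0, DS).
  have key : D * r = D * x - q * D * S := by rw [hr]; ring
  constructor
  · refine le_of_mul_le_mul_left ?_ hD
    rw [key]
    linarith
  · refine lt_of_mul_lt_mul_left ?_ hD.le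
    rw [key]
    linarith

theorem val_intMod (I : ℕ → SLP) (x : ℤ) {S : ℤ} (hS : 0 < S) : (intMod I x S).val = x % S := by
  set t := Nat.clog 2 (bits x) with ht
  set v := (reciprocal I S (bits S) t).val with hv
  set r := x - x * v / 2 ^ (bits S + 2 ^ t) * S with hr
  have hspec := reciprocal_spec I hS t
  rw [← hv, ← pow_add] at hspec
  -- The choice of `t` gives |x| < 2^(2^t); the additional factor 2 comes from 2 ≤ 2^`bits S`, as S
  -- is positive.
  have hx : 2 * |x| ≤ 2 ^ (bits S + 2 ^ t) := by
    have h1 := abs_lt_two_pow_bits x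
    have h2 : bits x ≤ 2 ^ t := Nat.le_pow_clog (by norm_num) _
    have h3 : (2 : ℤ) ^ bits x ≤ 2 ^ 2 ^ t := pow_le_pow_right₀ (by norm_num) h2
    have h4 := lt_two_pow_bits hS
    have h5 : (2 : ℤ) ≤ 2 ^ bits S := by
      have h6 : bits S ≠ 0 := by
        intro h0
        rw [h0] at h4
        norm_num at h4
        omega
      calc (2 : ℤ) = 2 ^ 1 := by norm_num
        _ ≤ _ := pow_le_pow_right₀ (by norm_num) (by omega)
    rw [pow_add]
    nlinarith [abs_nonneg x]
  obtain ⟨h1, h2⟩ := approx_quotient hS (by positivity) hspec hx hr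
  have hmod : x % S = r % S := by rw [hr]; simp [Int.sub_emod]
  have hval : (intMod I x S).val = if r < 0 then r + S else if r < S then r else r - S := by
    by_cases a : r < 0 <;> by_cases b : r < S <;>
    simp [intMod, ← ht, ← hv, ← hr, a, b]
  rw [hval, hmod]
  split_ifs with a b
  · rw [← Int.add_emod_right, Int.emod_eq_of_lt (by linarith) (by linarith)]
  · rw [Int.emod_eq_of_lt (by linarith) b]
  · rw [← Int.sub_emod_right, Int.emod_eq_of_lt (by linarith) (by linarith)]

theorem two_pow_clog_le_of_le {a b : ℕ} (h : a ≤ b) : 2 ^ Nat.clog 2 a ≤ 2 * b + 1 := by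
  rcases Nat.lt_or_ge 1 a with ha | ha
  · have h1 := Nat.pow_pred_clog_lt_self (b := 2) (by norm_num) ha
    have h2 : 0 < Nat.clog 2 a := Nat.clog_pos (by norm_num) ha
    obtain ⟨c, hc⟩ : ∃ c, Nat.clog 2 a = c + 1 := ⟨Nat.clog 2 a - 1, by omega⟩
    rw [hc, Nat.pred_succ] at h1
    rw [hc, pow_succ]
    omega
  · rw [Nat.clog_of_right_le_one ha]
    simp

/-- The precision 2^t is at most 2b + 1, so the reciprocal needs sizes up to 3(2b + 1) + b + 6,
which is below 8b + 16; the other intermediate results are smaller. -/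
theorem cost_intMod_le (I : ℕ → SLP) {x S : ℤ} (hS : 0 < S) {b : ℕ} (hx : bits x ≤ b)
    (hSb : bits S ≤ b) :
    (intMod I x S).cost ≤ (Nat.clog 2 b + 2) * (16 * arithCost I (8 * b + 16)) := by
  set t := Nat.clog 2 (bits x) with ht
  set A := arithCost I (8 * b + 16) with hA
  have hA' : 8 * b + 17 ≤ A := succ_le_arithCost I _
  have htb : t ≤ Nat.clog 2 b := Nat.clog_mono_right 2 hx
  have h2t : 2 ^ t ≤ 2 * b + 1 := two_pow_clog_le_of_le hx
  have hrec : (reciprocal I S (bits S) t).cost ≤ t * (8 * A) :=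
    cost_reciprocal_le I hS t _ (by omega)
  have hv := bits_reciprocal_le I hS t
  set v := (reciprocal I S (bits S) t).val with hvdef
  have h1 : bits (x * v) ≤ 3 * b + 3 := (bits_mul_le _ _).trans (by omega)
  have h2 := bits_shr_le (x * v) (bits S + 2 ^ t)
  set q := x * v / 2 ^ (bits S + 2 ^ t) with hq
  have h3 : bits (q * S) ≤ 4 * b + 3 := (bits_mul_le _ _).trans (by omega)
  have h4 : bits (x - q * S) ≤ 4 * b + 3 + 1 := bits_sub_le (by omega) h3
  have h5 := cost_mul_le I (x := x) (y := v) (b := 8 * b + 16) (by omega) (by omega)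
  have h6 := cost_mul_le I (x := q) (y := S) (b := 8 * b + 16) (by omega) (by omega)
  have h7 : t * (8 * A) ≤ Nat.clog 2 b * (16 * A) := Nat.mul_le_mul htb (by omega)
  set r := x - q * S with hr
  have e : (Nat.clog 2 b + 2) * (16 * A) = Nat.clog 2 b * (16 * A) + 32 * A := by ring
  rw [e]
  by_cases c1 : r < 0
  · simp [intMod, ← ht, ← hvdef, ← hq, ← hr, c1, -Comp.cost_mul]
    omega
  · by_cases c2 : r < S
    · simp [intMod, ← ht, ← hvdef, ← hq, ← hr, c1, c2, -Comp.cost_mul]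
      omega
    · simp [intMod, ← ht, ← hvdef, ← hq, ← hr, c1, c2, -Comp.cost_mul]
      omega

/-! ### Products and reductions of matrices -/

section EntryList

variable {α β : Type} {m : ℕ}

theorem mem_entryList {X : Matrix (Fin m) (Fin m) α} {x : α} :
    x ∈ entryList X ↔ ∃ i j, X i j = x := by simp [entryList]

theorem map_entryList (f : α → β) (X : Matrix (Fin m) (Fin m) α) :
    (entryList X).map f = entryList (X.map f) := by
  simp [entryList, List.map_flatMap, Function.comp_def]

theorem entryList_congr {X Y : Matrix (Fin m) (Fin m) α} (h : ∀ i j, X i j = Y i j) :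
    entryList X = entryList Y := by
  rw [Matrix.ext h]

@[simp] theorem length_entryList (X : Matrix (Fin m) (Fin m) α) :
    (entryList X).length = m * m := by
  simp [entryList, List.length_flatMap]

end EntryList

/-- The coefficients of `θ ^ 0, …, θ ^ (d - 1)` have bit size at most `b`. -/
def CoeffBits {m : ℕ} (d b : ℕ) (X : Matrix (Fin m) (Fin m) ℤ[X]) : Prop :=
  ∀ i j, ∀ c < d, bits ((X i j).coeff c) ≤ b

theorem CoeffBits.mono {m d b b' : ℕ} {X : Matrix (Fin m) (Fin m) ℤ[X]} (h : CoeffBits d b X)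
    (hb : b ≤ b') : CoeffBits d b' X := fun i j c hc => (h i j c hc).trans hb

theorem coeffBits_iff {m d b : ℕ} {X : Matrix (Fin m) (Fin m) ℤ[X]} :
    CoeffBits d b X ↔ ∀ x ∈ (encode d X).flatten, bits x ≤ b := by
  constructor
  · intro h x hx
    obtain ⟨l, hl, hx⟩ := List.mem_flatten.1 hx
    obtain ⟨i, j, rfl⟩ := mem_entryList.1 hl
    obtain ⟨c, hc, rfl⟩ := List.mem_map.1 hx
    exact h i j c (List.mem_range.1 hc)
  · intro h i j c hc
    refine h _ (List.mem_flatten.2 ⟨_, mem_entryList.2 ⟨i, j, rfl⟩, ?_⟩)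
    exact List.mem_map.2 ⟨c, List.mem_range.2 hc, rfl⟩

theorem length_flatten_encode {m : ℕ} (d : ℕ) (X : Matrix (Fin m) (Fin m) ℤ[X]) :
    (encode d X).flatten.length = m * m * d := by
  rw [List.length_flatten, encode, map_entryList]
  rw [List.sum_eq_card_nsmul _ d, length_entryList, smul_eq_mul]
  intro x hx
  obtain ⟨i, j, rfl⟩ := mem_entryList.1 hx
  simp

/-- A coefficient of index c < d is a sum of m(c + 1) ≤ md products, and these involve only
coefficients of index at most c. No bound on the degrees is needed. -/
theorem CoeffBits.mul {m d b b' : ℕ} {X Y : Matrix (Fin m) (Fin m) ℤ[X]} (hX : CoeffBits d b X)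
    (hY : CoeffBits d b' Y) : CoeffBits d (b + b' + m.size + d.size) (X * Y) := by
  intro i j c hc
  rw [bits_le_iff, Matrix.mul_apply, finsetSum_coeff]
  have h1 : ∀ k, |(X i k * Y k j).coeff c| ≤ d * (2 ^ b * 2 ^ b') := by
    intro k
    rw [coeff_mul]
    refine (Finset.abs_sum_le_sum_abs _ _).trans ?_
    have : ∀ x ∈ Finset.HasAntidiagonal.antidiagonal c, |(X i k).coeff x.1 * (Y k j).coeff x.2| ≤
        2 ^ b * 2 ^ b' := by
      intro x hx
      rw [Finset.HasAntidiagonal.mem_antidiagonal] at hx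
      rw [abs_mul]
      exact mul_le_mul (bits_le_iff.1 (hX i k _ (by omega))).le
        (bits_le_iff.1 (hY k j _ (by omega))).le (abs_nonneg _) (by positivity)
    refine (Finset.sum_le_card_nsmul _ _ _ this).trans ?_
    rw [Finset.Nat.card_antidiagonal, nsmul_eq_mul]
    exact mul_le_mul_of_nonneg_right (by exact_mod_cast hc) (by positivity)
  have h2 : |∑ k, (X i k * Y k j).coeff c| ≤ m * (d * (2 ^ b * 2 ^ b')) := by
    refine (Finset.abs_sum_le_sum_abs _ _).trans ?_
    refine (Finset.sum_le_card_nsmul _ _ _ (fun k _ => h1 k)).trans ?_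
    simp
  refine h2.trans_lt ?_
  have h3 : (m : ℤ) < 2 ^ m.size := by exact_mod_cast Nat.lt_size_self m
  have h4 : (d : ℤ) < 2 ^ d.size := by exact_mod_cast Nat.lt_size_self d
  have h5 : (m : ℤ) * d < 2 ^ m.size * 2 ^ d.size :=
    mul_lt_mul'' h3 h4 (by positivity) (by positivity)
  calc (m : ℤ) * (d * (2 ^ b * 2 ^ b')) = (m * d) * (2 ^ b * 2 ^ b') := by ring
    _ < 2 ^ m.size * 2 ^ d.size * (2 ^ b * 2 ^ b') := by gcongr
    _ = _ := by ring

theorem val_centre {B : ℕ} (hB : 1 ≤ B) {x : ℤ} (hx : bits x ≤ B - 1) :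
    (centre B (x % 2 ^ B)).val = x := by
  obtain ⟨e, rfl⟩ : ∃ e, B = e + 1 := ⟨B - 1, by omega⟩
  rw [bits_le_iff, abs_lt] at hx
  simp only [Nat.add_sub_cancel] at hx
  simp only [centre, Comp.val_bind, Comp.val_shl, Comp.val_add, Comp.val_low, Comp.val_sub,
    Nat.add_sub_cancel, one_mul, Int.emod_add_emod]
  rw [Int.emod_eq_of_lt (by linarith) (by rw [pow_succ]; linarith)]
  ring

theorem cost_centre_le (I : ℕ → SLP) {B : ℕ} (hB : 1 ≤ B) (x : ℤ) :
    (centre B (x % 2 ^ B)).cost ≤ 8 * arithCost I B := by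
  obtain ⟨e, rfl⟩ : ∃ e, B = e + 1 := ⟨B - 1, by omega⟩
  have h0 := succ_le_arithCost I (e + 1)
  have h1 := bits_emod_two_pow x (e + 1)
  have h2 := bits_two_pow e
  have h3 := bits_add_le h1 h2.le
  have h4 := bits_emod_two_pow (x % 2 ^ (e + 1) + 2 ^ e) (e + 1)
  simp only [centre, Comp.val_shl, Comp.val_add, Comp.val_low,
    Nat.add_sub_cancel, one_mul, Comp.cost_bind, Comp.cost_shl, Comp.cost_add, Comp.cost_low,
    Comp.cost_sub, bits_one]
  omega

/-- The cost has one truncated polynomial operation for each instruction of `A m`, together with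
linear work on the m²d coefficients for measuring, reducing and centring. -/
theorem matMul_spec {I P A : ℕ → SLP} (hP : ∀ d, MultipliesPolynomials d (P d))
    (hA : ∀ m, MultipliesMatrices m (A m)) {m d b : ℕ} (hd : 1 ≤ d)
    {X Y : Matrix (Fin m) (Fin m) ℤ[X]} (hX : CoeffBits d b X) (hY : CoeffBits d b Y) :
    (matMul I P A m d (encode d X) (encode d Y)).val = encode d (X * Y) ∧
    (matMul I P A m d (encode d X) (encode d Y)).cost ≤
      ((A m).length + m * m) * ((P d).length + d) *
        (24 * arithCost I (2 * b + m.size + d.size + 2)) := by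
  have hXY : ∀ x ∈ (encode d X).flatten ++ (encode d Y).flatten, bits x ≤ b := by
    intro x hx
    rcases List.mem_append.1 hx with hx | hx
    · exact coeffBits_iff.1 hX x hx
    · exact coeffBits_iff.1 hY x hx
  -- The modulus is chosen from the measured size `b'`, whereas the cost is stated with the a priori
  -- bound `b`.
  set b' := (maxBits ((encode d X).flatten ++ (encode d Y).flatten)).val with hb'
  have hbb : b' ≤ b := maxBits_le hXY
  have hX' : CoeffBits d b' X := coeffBits_iff.2 fun x hx =>
    bits_le_maxBits (List.mem_append_left _ hx)
  have hY' : CoeffBits d b' Y := coeffBits_iff.2 fun x hx =>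
    bits_le_maxBits (List.mem_append_right _ hx)
  set B := 2 * b' + m.size + d.size + 2 with hB
  have hB1 : 1 ≤ B := by omega
  have hZ := hX'.mul hY'
  have hlow : ∀ W : Matrix (Fin m) (Fin m) ℤ[X],
      (Comp.map (Comp.map (Comp.low B)) (encode d W)).val =
      (entryList W).map (fun f => (coeffList d f).map (· % 2 ^ B)) := by
    intro W
    simp [encode, ← map_entryList]
  -- The run on truncated residues is compared with the run of `A m` over ℤ[X], where it computes
  -- the exact product.
  have hex := (truncPolyOps_implements I P hB1 hd (hP d)).slp (A m)
    (forall₂_eq_map (f := fun f : ℤ[X] => (coeffList d f).map (· % 2 ^ B)).2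
      (rfl : (entryList X ++ entryList Y).map _ = _))
  rw [forall₂_eq_map, hA m, List.map_append, ← hlow, ← hlow] at hex
  obtain ⟨hv, hc⟩ := hex
  set Z := (A m).exec (truncPolyOps I P B d) ((Comp.map (Comp.map (Comp.low B)) (encode d X)).val ++
    (Comp.map (Comp.map (Comp.low B)) (encode d Y)).val) with hZdef
  constructor
  · rw [show (matMul I P A m d (encode d X) (encode d Y)).val =
      (Comp.map (Comp.map (centre B)) Z.val).val from rfl, hv]
    simp only [Comp.val_map]
    rw [encode, ← map_entryList, List.map_map]
    refine List.map_congr_left fun f hf => ?_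
    obtain ⟨i, j, rfl⟩ := mem_entryList.1 hf
    simp only [Function.comp_apply, List.map_map, coeffList]
    refine List.map_congr_left fun c hc => ?_
    exact val_centre hB1 ((hZ i j c (List.mem_range.1 hc)).trans (by omega))
  · have hA0 := succ_le_arithCost I B
    have hmono : arithCost I B ≤ arithCost I (2 * b + m.size + d.size + 2) :=
      arithCost_mono I (by omega)
    have c1 : (maxBits ((encode d X).flatten ++ (encode d Y).flatten)).cost ≤
        (m * m * d + m * m * d) * (b' + 1) := by
      refine (cost_maxBits_le fun x hx => bits_le_maxBits hx).trans ?_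
      rw [List.length_append, length_flatten_encode, length_flatten_encode]
    have c2 : ∀ W : Matrix (Fin m) (Fin m) ℤ[X], CoeffBits d b' W →
        (Comp.map (Comp.map (Comp.low B)) (encode d W)).cost ≤ m * m * (d * (2 * B + 1)) := by
      intro W hW
      refine (Comp.cost_map_le _ _ (d * (2 * B + 1)) fun l hl => ?_).trans (by simp [encode])
      obtain ⟨i, j, rfl⟩ := mem_entryList.1 hl
      refine (Comp.cost_map_le _ _ (2 * B + 1) fun x hx => ?_).trans (by simp)
      obtain ⟨c, hc, rfl⟩ := List.mem_map.1 hx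
      have := hW i j c (List.mem_range.1 hc)
      rw [Comp.cost_low]
      omega
    have c3 : (Comp.map (Comp.map (centre B)) Z.val).cost ≤ m * m * (d * (8 * arithCost I B)) := by
      rw [hv]
      refine (Comp.cost_map_le _ _ (d * (8 * arithCost I B)) fun l hl => ?_).trans (by simp)
      obtain ⟨f, -, rfl⟩ := List.mem_map.1 hl
      refine (Comp.cost_map_le _ _ (8 * arithCost I B) fun x hx => ?_).trans (by simp)
      obtain ⟨y, -, rfl⟩ := List.mem_map.1 hx
      exact cost_centre_le I hB1 y
    have c2X := c2 X hX'
    have c2Y := c2 Y hY'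
    simp only [matMul, Comp.cost_bind, ← hb', ← hB, ← hZdef]
    set a := arithCost I B
    have e1 : (m * m * d + m * m * d) * (b' + 1) ≤ m * m * (d * (2 * a)) := by
      calc _ = m * m * (d * (2 * (b' + 1))) := by ring
        _ ≤ _ := by gcongr; omega
    have e2 : m * m * (d * (2 * B + 1)) ≤ m * m * (d * (2 * a)) := by gcongr; omega
    have e3 : (A m).length * (((P d).length + d) * (6 * a) + 1) ≤
        (A m).length * (((P d).length + d) * (7 * a)) := by
      gcongr
      have : 1 ≤ ((P d).length + d) * a := Nat.mul_pos (by omega) (by omega)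
      linarith
    calc _ ≤ (A m).length * (((P d).length + d) * (7 * a)) + m * m * (d * (14 * a)) := by
          linarith
      _ ≤ (A m).length * (((P d).length + d) * (24 * a)) +
          m * m * (((P d).length + d) * (24 * a)) := by gcongr <;> omega
      _ = ((A m).length + m * m) * ((P d).length + d) * (24 * a) := by ring
      _ ≤ _ := by gcongr

/-! ### Reduction and congruence of polynomial matrices modulo (S, θ^d) -/

/-- Reduction of all coefficients modulo `S`. -/
noncomputable def reducePoly (S : ℤ) (f : ℤ[X]) : ℤ[X] :=
  ∑ i ∈ f.support, monomial i (f.coeff i % S)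

@[simp] theorem coeff_reducePoly (S : ℤ) (f : ℤ[X]) (i : ℕ) :
    (reducePoly S f).coeff i = f.coeff i % S := by
  simp only [reducePoly, finsetSum_coeff, coeff_monomial, Finset.sum_ite_eq', mem_support_iff]
  split_ifs with h
  · rfl
  · rw [not_not] at h
    simp [h]

theorem coeffBits_reduce {m : ℕ} (d : ℕ) (X : Matrix (Fin m) (Fin m) ℤ[X]) {S : ℤ} (hS : 0 < S) :
    CoeffBits d (bits S) (X.map (reducePoly S)) := by
  intro i j c _
  rw [Matrix.map_apply, coeff_reducePoly]
  exact bits_emod_le _ hS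

theorem encodeMod_eq {m : ℕ} (p d : ℕ) (X : Matrix (Fin m) (Fin m) ℤ[X]) :
    encodeMod p d X = encode d (X.map (reducePoly p)) := by
  rw [encodeMod, encode]
  refine entryList_congr fun i j => ?_
  simp [coeffList]

theorem matMod_spec (I : ℕ → SLP) {m d b : ℕ} {X : Matrix (Fin m) (Fin m) ℤ[X]}
    (hX : CoeffBits d b X) {S : ℤ} (hS : 0 < S) (hSb : bits S ≤ b) :
    (matMod I (encode d X) S).val = encode d (X.map (reducePoly S)) ∧
    (matMod I (encode d X) S).cost ≤
      m * m * (d * ((Nat.clog 2 b + 2) * (16 * arithCost I (8 * b + 16)))) := by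
  constructor
  · simp only [matMod, Comp.val_map, encode, val_intMod I _ hS]
    rw [map_entryList]
    refine entryList_congr fun i j => ?_
    simp [coeffList]
  · refine (Comp.cost_map_le _ _ _ fun l hl => ?_).trans (by rw [encode, length_entryList])
    obtain ⟨i, j, rfl⟩ := mem_entryList.1 hl
    refine (Comp.cost_map_le _ _ _ fun x hx => ?_).trans
      (by rw [Matrix.map_apply, length_coeffList])
    obtain ⟨c, hc, rfl⟩ := List.mem_map.1 hx
    exact cost_intMod_le I hS (hX i j c (List.mem_range.1 hc)) hSb

/-- Congruence of matrices modulo `(S, θ ^ d)`. -/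
def CongrMod {m : ℕ} (d : ℕ) (S : ℤ) (X Y : Matrix (Fin m) (Fin m) ℤ[X]) : Prop :=
  ∀ i j, ∀ c < d, (X i j).coeff c ≡ (Y i j).coeff c [ZMOD S]

namespace CongrMod

variable {m d : ℕ} {S S' : ℤ} {X X' Y Y' Z : Matrix (Fin m) (Fin m) ℤ[X]}

theorem refl (X : Matrix (Fin m) (Fin m) ℤ[X]) : CongrMod d S X X :=
  fun _ _ _ _ => Int.ModEq.refl _

theorem trans (h : CongrMod d S X Y) (h' : CongrMod d S Y Z) : CongrMod d S X Z :=
  fun i j c hc => (h i j c hc).trans (h' i j c hc)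

theorem of_dvd (h : CongrMod d S X Y) (hS : S' ∣ S) : CongrMod d S' X Y :=
  fun i j c hc => (h i j c hc).of_dvd hS

theorem reduce (X : Matrix (Fin m) (Fin m) ℤ[X]) : CongrMod d S (X.map (reducePoly S)) X := by
  intro i j c _
  rw [Matrix.map_apply, coeff_reducePoly]
  exact Int.mod_modEq _ _

theorem mul (h : CongrMod d S X X') (h' : CongrMod d S Y Y') :
    CongrMod d S (X * Y) (X' * Y') := by
  intro i j c hc
  rw [Matrix.mul_apply, Matrix.mul_apply, finsetSum_coeff, finsetSum_coeff]
  refine Int.ModEq.sum fun k _ => ?_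
  rw [coeff_mul, coeff_mul]
  refine Int.ModEq.sum fun x hx => ?_
  rw [Finset.HasAntidiagonal.mem_antidiagonal] at hx
  exact (h i k _ (by omega)).mul (h' k j _ (by omega))

/-- Congruent integers have equal remainders, so a congruence suffices to determine the output of
the algorithm exactly. -/
theorem encode_reduce_eq (h : CongrMod d S X Y) :
    encode d (X.map (reducePoly S)) = encode d (Y.map (reducePoly S)) := by
  refine entryList_congr fun i j => coeffList_congr fun c hc => ?_
  simp only [Matrix.map_apply, coeff_reducePoly]
  exact h i j c hc

end CongrMod

theorem oneMat_eq (m : ℕ) {d : ℕ} (hd : 1 ≤ d) :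
    oneMat m d = encode d (1 : Matrix (Fin m) (Fin m) ℤ[X]) := by
  refine entryList_congr fun i j => ?_
  obtain ⟨e, rfl⟩ : ∃ e, d = e + 1 := ⟨d - 1, by omega⟩
  rw [Matrix.map_apply, Matrix.one_apply]
  split_ifs
  · simp [onePoly, coeffList, Function.comp_def, List.range_succ_eq_map, coeff_one]
  · symm
    simp only [zeroPoly, List.eq_replicate_iff]
    simp [coeffList]

theorem coeffBits_one (m d : ℕ) : CoeffBits d 1 (1 : Matrix (Fin m) (Fin m) ℤ[X]) := by
  intro i j c _
  rw [Matrix.one_apply]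
  split_ifs
  · rw [coeff_one]
    split_ifs <;> simp
  · simp

/-! ### Translation of polynomials -/

theorem natDegree_lt_of_degree_lt_natCast {f : ℤ[X]} {d : ℕ} (hd : 1 ≤ d) (hf : f.degree < d) :
    f.natDegree < d := by
  by_cases h : f = 0
  · subst h; simpa using Nat.pos_of_ne_zero (by omega)
  · exact (natDegree_lt_iff_degree_lt h).2 hf

theorem degree_comp_X_add_C_lt {f : ℤ[X]} {d : ℕ} (hf : f.degree < d) (a : ℤ) :
    (f.comp (X + C a)).degree < d := by
  rw [← taylor_apply, degree_taylor]
  exact hf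

/-- As a ≥ 0, each coefficient of (θ + a)^j is one term of the binomial expansion of (1 + a)^j,
hence at most (a + 1)^d for j < d. Summing over the `d` coefficients of `q` adds `d.size` bits. -/
theorem bits_coeff_comp_le {d b : ℕ} (hd : 1 ≤ d) {q : ℤ[X]} (hq : q.degree < d)
    (hb : ∀ c < d, bits (q.coeff c) ≤ b) {a : ℤ} (ha : 0 ≤ a) (i : ℕ) :
    bits ((q.comp (X + C a)).coeff i) ≤ b + d.size + d * bits (a + 1) := by
  have hpos : 0 < a + 1 := by omega
  rw [bits_le_iff, comp, eval₂_eq_sum_range' C (natDegree_lt_of_degree_lt_natCast hd hq),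
    finsetSum_coeff]
  have h1 : ∀ j ∈ Finset.range d, |(C (q.coeff j) * (X + C a) ^ j).coeff i| ≤
      2 ^ b * 2 ^ (d * bits (a + 1)) := by
    intro j hj
    rw [Finset.mem_range] at hj
    have h2 : |((X + C a) ^ j).coeff i| ≤ 2 ^ (d * bits (a + 1)) := by
      rw [coeff_X_add_C_pow, abs_of_nonneg (by positivity)]
      have h3 : a ^ (j - i) * (j.choose i : ℤ) ≤ (1 + a) ^ j := by
        rcases le_or_gt i j with hij | hij
        · rw [add_pow]
          have := Finset.single_le_sum (f := fun m => (1 : ℤ) ^ m * a ^ (j - m) * (j.choose m : ℤ))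
            (fun m _ => by positivity) (Finset.mem_range.2 (Nat.lt_succ_of_le hij))
          simpa using this
        · rw [Nat.choose_eq_zero_of_lt hij]
          simp only [Nat.cast_zero, mul_zero]
          positivity
      calc a ^ (j - i) * (j.choose i : ℤ) ≤ (1 + a) ^ j := h3
        _ = (a + 1) ^ j := by rw [add_comm]
        _ ≤ (a + 1) ^ d := pow_le_pow_right₀ (by omega) hj.le
        _ ≤ (2 ^ bits (a + 1)) ^ d := by
          gcongr
          exact (lt_two_pow_bits hpos).le
        _ = _ := by rw [← pow_mul, mul_comm]
    rw [coeff_C_mul, abs_mul]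
    exact mul_le_mul (bits_le_iff.1 (hb j hj)).le h2 (abs_nonneg _) (by positivity)
  refine (Finset.abs_sum_le_sum_abs _ _).trans_lt ?_
  refine (Finset.sum_le_card_nsmul _ _ _ h1).trans_lt ?_
  rw [Finset.card_range, nsmul_eq_mul]
  have h4 : (d : ℤ) < 2 ^ d.size := by exact_mod_cast Nat.lt_size_self d
  calc (d : ℤ) * (2 ^ b * 2 ^ (d * bits (a + 1)))
      < 2 ^ d.size * (2 ^ b * 2 ^ (d * bits (a + 1))) := by gcongr
    _ = _ := by ring

/-- `Q` bounds the average cost of a multiplication of polynomials of degree less than `d`. -/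
def PolyCost (P : ℕ → SLP) (d Q : ℕ) : Prop :=
  1 ≤ Q ∧ ∀ e, 1 ≤ e → e ≤ d → (P e).length + e ≤ Q * e

/-- Repeated squaring doubles the length at each step, so the costs form a geometric sum dominated
by the last product. -/
theorem linearPow_spec (I : ℕ → SLP) {P : ℕ → SLP} (hP : ∀ d, MultipliesPolynomials d (P d))
    {d Q : ℕ} (hQ : PolyCost P d Q) {B : ℕ} (hB : 1 ≤ B) {a : ℤ} (ha : bits a ≤ B) (t : ℕ)
    (ht : 2 ^ t ≤ 2 * (d - 1) + 1) :
    (linearPow I P B a t).val = (coeffList (2 ^ t + 1) ((X + C a) ^ 2 ^ t)).map (· % 2 ^ B) ∧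
    (linearPow I P B a t).cost ≤ 2 ^ t * (Q * (12 * arithCost I B)) := by
  have hA0 := succ_le_arithCost I B
  obtain ⟨hQ1, hQ⟩ := hQ
  induction t with
  | zero =>
    constructor
    · have h1 : (1 : ℤ) % 2 ^ B = 1 := (residueOps_implements I hB).one.symm
      have h2 : (X + C a : ℤ[X]).coeff 1 = 1 := by simp [coeff_X, -eq_intCast]
      have h3 : (X + C a : ℤ[X]).coeff 0 = a := by simp [-eq_intCast]
      simp [linearPow, coeffList, List.range_succ, h1, h2, h3, -eq_intCast, -coeff_add]
    · simp only [linearPow, Comp.cost_bind, Comp.cost_low, Comp.cost_pure, pow_zero, one_mul]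
      have := Nat.mul_le_mul hQ1 (le_refl (12 * arithCost I B))
      linarith
  | succ t ih =>
    have h1t := Nat.one_le_two_pow (n := t)
    -- Since 2^(t+1) is even, it is at most 2(d − 1). Thus the factors, with 2^t + 1 coefficients,
    -- are within the range of `PolyCost P d Q`.
    have htd : 2 ^ t + 1 ≤ d := by rw [pow_succ] at ht; omega
    obtain ⟨h1, h2⟩ := ih (by omega)
    have hdeg : ((X + C a : ℤ[X]) ^ 2 ^ t).degree < (2 ^ t + 1 : ℕ) := by
      rw [degree_pow, degree_X_add_C, nsmul_one]
      exact_mod_cast Nat.lt_succ_self _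
    obtain ⟨h3, h4⟩ := exec_polyMul I hB (hP (2 ^ t + 1)) hdeg hdeg
    rw [← h1] at h3 h4
    constructor
    · simp only [linearPow, Comp.val_bind, Comp.val_pure]
      rw [h3, ← List.map_take, take_coeffList (by rw [pow_succ]; omega), ← pow_add, pow_succ 2 t,
        mul_two]
    · simp only [linearPow, Comp.cost_bind, Comp.cost_pure]
      have h5 := hQ (2 ^ t + 1) (by omega) htd
      have h6 : (P (2 ^ t + 1)).length * (6 * arithCost I B) ≤
          2 ^ t * (Q * (12 * arithCost I B)) := by
        calc _ ≤ (Q * (2 ^ t + 1)) * (6 * arithCost I B) :=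
            Nat.mul_le_mul_right _ ((Nat.le_add_right _ _).trans h5)
          _ ≤ (Q * (2 ^ t + 2 ^ t)) * (6 * arithCost I B) := by
            have := Nat.one_le_two_pow (n := t)
            gcongr
          _ = _ := by ring
      rw [pow_succ]
      linarith

theorem coeffList_map_append_replicate {d e B : ℕ} {f : ℤ[X]} (hf : f.degree < d) :
    (coeffList d f).map (· % 2 ^ B) ++ List.replicate e 0 =
      (coeffList (d + e) f).map (· % 2 ^ B) := by
  rw [coeffList_add, List.map_append]
  congr 1
  symm
  rw [List.eq_replicate_iff]
  refine ⟨by simp, fun x hx => ?_⟩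
  simp only [List.map_map, List.mem_map] at hx
  obtain ⟨i, -, rfl⟩ := hx
  simp [coeff_eq_zero_of_degree_lt (hf.trans_le (by exact_mod_cast Nat.le_add_right d i))]

/-- Write q = q₀ + θ^(2^t) q₁; then q(θ + a) = q₀(θ + a) + (θ + a)^(2^t) q₁(θ + a). Recomputing the
power of θ + a in each call costs no more, in order, than the product that uses it, so each of the
`t` levels has quasi-linear cost. -/
theorem translateRec_spec (I : ℕ → SLP) {P : ℕ → SLP} (hP : ∀ d, MultipliesPolynomials d (P d))
    {d Q : ℕ} (hQ : PolyCost P d Q) {B : ℕ} (hB : 1 ≤ B) {a : ℤ} (ha : bits a ≤ B) (t : ℕ)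
    (ht : 2 ^ t ≤ 2 * (d - 1) + 1) (q : ℤ[X]) (hq : q.degree < (2 ^ t : ℕ)) :
    (translateRec I P B a t ((coeffList (2 ^ t) q).map (· % 2 ^ B))).val =
      (coeffList (2 ^ t) (q.comp (X + C a))).map (· % 2 ^ B) ∧
    (translateRec I P B a t ((coeffList (2 ^ t) q).map (· % 2 ^ B))).cost ≤
      t * (2 ^ t * (Q * (17 * arithCost I B))) := by
  induction t generalizing q with
  | zero =>
    rw [eq_C_of_degree_le_zero (p := q) (by
      rw [pow_zero, Nat.cast_one] at hq
      exact Nat.WithBot.lt_one_iff_le_zero.1 hq)]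
    simp [translateRec]
  | succ t ih =>
    have h1t := Nat.one_le_two_pow (n := t)
    have htd : 2 ^ t + 1 ≤ d := by rw [pow_succ] at ht; omega
    set ql := truncPoly (2 ^ t) q with hql
    set qh : ℤ[X] := ∑ i ∈ Finset.range (2 ^ t), monomial i (q.coeff (2 ^ t + i)) with hqh
    have hqhc : ∀ i, qh.coeff i = if i < 2 ^ t then q.coeff (2 ^ t + i) else 0 := by
      intro i
      simp [hqh, coeff_monomial]
    have hqhd : qh.degree < (2 ^ t : ℕ) := by
      rw [degree_lt_iff_coeff_zero]
      intro i hi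
      rw [hqhc, if_neg (by exact_mod_cast hi.not_gt)]
    have hqld : ql.degree < (2 ^ t : ℕ) := degree_truncPoly_lt _ _
    have hsum : q = ql + X ^ 2 ^ t * qh := by
      ext i
      rw [coeff_add, coeff_X_pow_mul', hql, coeff_truncPoly, hqhc]
      rcases lt_or_ge i (2 ^ t) with h | h
      · rw [if_pos h, if_neg (by omega), add_zero]
      · rw [if_neg (by omega), if_pos h, zero_add]
        split_ifs with h'
        · congr 1; omega
        · refine coeff_eq_zero_of_degree_lt (hq.trans_le ?_)
          rw [pow_succ]
          exact_mod_cast (by omega : 2 ^ t * 2 ≤ i)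
    have hcomp : q.comp (X + C a) =
        ql.comp (X + C a) + (X + C a) ^ 2 ^ t * qh.comp (X + C a) := by
      conv_lhs => rw [hsum]
      simp
    have htake : ((coeffList (2 ^ (t + 1)) q).map (· % 2 ^ B)).take (2 ^ t) =
        (coeffList (2 ^ t) ql).map (· % 2 ^ B) := by
      rw [← List.map_take, take_coeffList (by rw [pow_succ]; omega), hql, coeffList_truncPoly]
    have hdrop : ((coeffList (2 ^ (t + 1)) q).map (· % 2 ^ B)).drop (2 ^ t) =
        (coeffList (2 ^ t) qh).map (· % 2 ^ B) := by
      rw [pow_succ, mul_two, coeffList_add, ← List.map_drop,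
        List.drop_left' (length_coeffList _ _)]
      congr 1
      refine List.map_congr_left fun i hi => ?_
      rw [hqhc, if_pos (List.mem_range.1 hi)]
    obtain ⟨l1, l2⟩ := ih (by omega) ql hqld
    obtain ⟨u1, u2⟩ := ih (by omega) qh hqhd
    obtain ⟨p1, p2⟩ := linearPow_spec I hP hQ hB ha t (by omega)
    have hqlc := degree_comp_X_add_C_lt hqld a
    have hqhc' := degree_comp_X_add_C_lt hqhd a
    have hdeg : ((X + C a : ℤ[X]) ^ 2 ^ t).degree < (2 ^ t + 1 : ℕ) := by
      rw [degree_pow, degree_X_add_C, nsmul_one]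
      exact_mod_cast Nat.lt_succ_self _
    obtain ⟨m1, m2⟩ := exec_polyMul I hB (hP (2 ^ t + 1)) hdeg
      (hqhc'.trans_le (by exact_mod_cast Nat.le_succ _))
    -- The power of θ + a has 2^t + 1 coefficients, one more than the upper half, which is therefore
    -- padded by a zero.
    have hH : (translateRec I P B a t ((coeffList (2 ^ t) qh).map (· % 2 ^ B))).val ++ [0] =
        (coeffList (2 ^ t + 1) (qh.comp (X + C a))).map (· % 2 ^ B) := by
      rw [u1]
      exact coeffList_map_append_replicate (e := 1) hqhc'
    have hL : (translateRec I P B a t ((coeffList (2 ^ t) ql).map (· % 2 ^ B))).val ++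
        List.replicate (2 ^ t) 0 =
        (coeffList (2 ^ (t + 1)) (ql.comp (X + C a))).map (· % 2 ^ B) := by
      rw [l1, coeffList_map_append_replicate hqlc, pow_succ 2 t, mul_two]
    rw [← p1, ← hH] at m1 m2
    have ho := residueOps_implements I hB
    simp only [translateRec, Comp.val_bind, Comp.cost_bind]
    rw [htake, hdrop, hL, m1, ← List.map_take, take_coeffList (by rw [pow_succ]; omega)]
    constructor
    · rw [Comp.val_zip]
      refine coeffList_zipWith fun i _ => ?_
      rw [(ho.add rfl rfl).1, hcomp, coeff_add]
    · have hz : ∀ f g : ℤ[X], (Comp.zip (residueOps I B).add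
          ((coeffList (2 ^ (t + 1)) f).map (· % 2 ^ B))
          ((coeffList (2 ^ (t + 1)) g).map (· % 2 ^ B))).cost ≤
          2 ^ (t + 1) * (5 * arithCost I B) := by
        intro f g
        refine (Comp.cost_zip_le _ _ _ (5 * arithCost I B) ?_).trans (by simp)
        intro x hx y hy
        obtain ⟨x', -, rfl⟩ := List.mem_map.1 hx
        obtain ⟨y', -, rfl⟩ := List.mem_map.1 hy
        exact (ho.add rfl rfl).2
      have hz' := hz (ql.comp (X + C a)) ((X + C a) ^ 2 ^ t * qh.comp (X + C a))
      obtain ⟨hQ1, hQ⟩ := hQ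
      have h5 := hQ (2 ^ t + 1) (by omega) htd
      have h6 : (P (2 ^ t + 1)).length * (6 * arithCost I B) ≤
          2 ^ t * (Q * (12 * arithCost I B)) := by
        calc _ ≤ (Q * (2 ^ t + 1)) * (6 * arithCost I B) :=
            Nat.mul_le_mul_right _ ((Nat.le_add_right _ _).trans h5)
          _ ≤ (Q * (2 ^ t + 2 ^ t)) * (6 * arithCost I B) := by
            have := Nat.one_le_two_pow (n := t)
            gcongr
          _ = _ := by ring
      have h7 : 2 ^ (t + 1) * (5 * arithCost I B) ≤ 2 ^ (t + 1) * (Q * (5 * arithCost I B)) := by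
        exact Nat.mul_le_mul_left _ (Nat.le_mul_of_pos_left _ hQ1)
      -- 17 = 12 + 5: the power and the product each cost 12 units on length 2^t, the addition 5
      -- units on length 2^(t+1).
      have h8 : (t + 1) * (2 ^ (t + 1) * (Q * (17 * arithCost I B))) =
          2 * (t * (2 ^ t * (Q * (17 * arithCost I B)))) +
          2 * (2 ^ t * (Q * (12 * arithCost I B))) + 2 ^ (t + 1) * (Q * (5 * arithCost I B)) := by
        ring
      rw [h8]
      linarith

theorem translate_spec (I : ℕ → SLP) {P : ℕ → SLP} (hP : ∀ d, MultipliesPolynomials d (P d))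
    {d Q : ℕ} (hd : 1 ≤ d) (hQ : PolyCost P d Q) {q : ℤ[X]} (hq : q.degree < d) {b : ℕ}
    (hb : ∀ c < d, bits (q.coeff c) ≤ b) {a : ℤ} (ha : 0 ≤ a) :
    (translate I P d a (coeffList d q)).val = coeffList d (q.comp (X + C a)) ∧
    (translate I P d a (coeffList d q)).cost ≤
      (Nat.clog 2 d + 1) * (d * (Q * (64 * arithCost I (b + d.size + d * bits (a + 1) + 2)))) := by
  have hmem : ∀ x ∈ coeffList d q, bits x ≤ b := by
    intro x hx
    obtain ⟨c, hc, rfl⟩ := List.mem_map.1 hx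
    exact hb c (List.mem_range.1 hc)
  set b' := (maxBits (coeffList d q)).val with hb'
  have hbb : b' ≤ b := maxBits_le hmem
  have hq' : ∀ c < d, bits (q.coeff c) ≤ b' := fun c hc =>
    bits_le_maxBits (List.mem_map.2 ⟨c, List.mem_range.2 hc, rfl⟩)
  set B := b' + d.size + d * bits (a + 1) + 2 with hB
  have hB1 : 1 ≤ B := by omega
  set t := Nat.clog 2 d with ht
  have hdt : d ≤ 2 ^ t := Nat.le_pow_clog (by norm_num) _
  -- This form covers d = 1, where t = 0, as well as d ≥ 2, where 2^t < 2d is even.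
  have htd : 2 ^ t ≤ 2 * (d - 1) + 1 := by
    rcases Nat.lt_or_ge 1 d with h | h
    · have h1 := Nat.pow_pred_clog_lt_self (b := 2) (by norm_num) h
      have h2 : 0 < Nat.clog 2 d := Nat.clog_pos (by norm_num) h
      obtain ⟨c, hc⟩ : ∃ c, Nat.clog 2 d = c + 1 := ⟨Nat.clog 2 d - 1, by omega⟩
      rw [hc, Nat.pred_succ] at h1
      rw [ht, hc, pow_succ]
      omega
    · rw [ht, Nat.clog_of_right_le_one h]
      simp
  have haB1 : bits (a + 1) ≤ d * bits (a + 1) := Nat.le_mul_of_pos_left _ hd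
  have haa : bits a ≤ bits (a + 1) := bits_le_of_abs_le (by
    rw [abs_of_nonneg ha, abs_of_nonneg (by omega)]; omega)
  have hq2 : q.degree < (2 ^ t : ℕ) := hq.trans_le (by exact_mod_cast hdt)
  have hpad : coeffList d q ++ List.replicate (2 ^ t - d) 0 = coeffList (2 ^ t) q := by
    obtain ⟨e, he⟩ := Nat.exists_eq_add_of_le hdt
    rw [he, Nat.add_sub_cancel_left, coeffList_add]
    congr 1
    symm
    rw [List.eq_replicate_iff]
    refine ⟨by simp, fun x hx => ?_⟩
    obtain ⟨i, -, rfl⟩ := List.mem_map.1 hx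
    exact coeff_eq_zero_of_degree_lt (hq.trans_le (by exact_mod_cast Nat.le_add_right d i))
  have hlow : (Comp.map (Comp.low B) (coeffList d q ++ List.replicate (2 ^ t - d) 0)).val =
      (coeffList (2 ^ t) q).map (· % 2 ^ B) := by
    rw [hpad, Comp.val_map]
    rfl
  obtain ⟨r1, r2⟩ := translateRec_spec I hP hQ hB1 (a := a) (by omega) t htd q hq2
  rw [← hlow] at r1 r2
  set R := translateRec I P B a t
    (Comp.map (Comp.low B) (coeffList d q ++ List.replicate (2 ^ t - d) 0)).val with hR
  have htake : R.val.take d = (coeffList d (q.comp (X + C a))).map (· % 2 ^ B) := by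
    rw [r1, ← List.map_take, take_coeffList hdt]
  constructor
  · rw [show (translate I P d a (coeffList d q)).val =
      (Comp.map (centre B) (R.val.take d)).val from rfl, htake, Comp.val_map, List.map_map]
    conv_rhs => rw [← List.map_id (coeffList d (q.comp (X + C a)))]
    refine List.map_congr_left fun x hx => ?_
    obtain ⟨c, hc, rfl⟩ := List.mem_map.1 hx
    exact val_centre hB1 ((bits_coeff_comp_le hd hq hq' ha c).trans (by omega))
  · have hA0 := succ_le_arithCost I B
    have hmono : arithCost I B ≤ arithCost I (b + d.size + d * bits (a + 1) + 2) :=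
      arithCost_mono I (by omega)
    have c1 : (maxBits (coeffList d q)).cost ≤ d * (b' + 1) :=
      (cost_maxBits_le fun x hx => bits_le_maxBits hx).trans
        (by rw [length_coeffList])
    have c2 : (Comp.map (Comp.low B) (coeffList d q ++ List.replicate (2 ^ t - d) 0)).cost ≤
        2 ^ t * (2 * B + 1) := by
      refine (Comp.cost_map_le _ _ (2 * B + 1) fun x hx => ?_).trans (by simp [hpad])
      have : bits x ≤ b' := by
        rcases List.mem_append.1 hx with hx | hx
        · exact bits_le_maxBits hx
        · rw [List.eq_of_mem_replicate hx]
          simp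
      rw [Comp.cost_low]
      omega
    have c3 : (Comp.map (centre B) (R.val.take d)).cost ≤ d * (8 * arithCost I B) := by
      rw [htake]
      refine (Comp.cost_map_le _ _ (8 * arithCost I B) fun x hx => ?_).trans (by simp)
      obtain ⟨y, -, rfl⟩ := List.mem_map.1 hx
      exact cost_centre_le I hB1 y
    have htotal : (translate I P d a (coeffList d q)).cost =
        (maxBits (coeffList d q)).cost + ((bits a + bits 1 + 1) + ((bits (a + 1) + 1) +
        ((Comp.map (Comp.low B) (coeffList d q ++ List.replicate (2 ^ t - d) 0)).cost +
        (R.cost + (Comp.map (centre B) (R.val.take d)).cost)))) := rfl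
    rw [htotal, bits_one]
    obtain ⟨hQ1, -⟩ := hQ
    set K := arithCost I B
    have e1 : d * (b' + 1) ≤ d * K := by gcongr; omega
    have e2 : 2 ^ t * (2 * B + 1) ≤ (2 * d) * (2 * K) := by gcongr <;> omega
    have e3 : t * (2 ^ t * (Q * (17 * K))) ≤ t * ((2 * d) * (Q * (17 * K))) := by
      gcongr; omega
    have e4 : K ≤ d * K := Nat.le_mul_of_pos_left _ hd
    have e5 : d * K ≤ d * (Q * K) := by
      gcongr
      exact Nat.le_mul_of_pos_left _ hQ1
    calc _ ≤ 17 * (d * K) + t * ((2 * d) * (Q * (17 * K))) := by linarith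
      _ ≤ 64 * (d * (Q * K)) + t * (64 * (d * (Q * K))) := by
        have : t * ((2 * d) * (Q * (17 * K))) ≤ t * (64 * (d * (Q * K))) := by
          exact Nat.mul_le_mul_left _ (by linarith [Nat.zero_le (d * (Q * K))])
        linarith
      _ = (t + 1) * (d * (Q * (64 * K))) := by ring
      _ ≤ _ := by gcongr

/-! ### The sieve of Eratosthenes -/

/-- The number `k` is fuel. An early exit loses nothing, since all later multiples exceed `N`. -/
theorem val_crossOut (N p k q : ℕ) (f : ℕ → Bool) (x : ℕ) :
    (crossOut N p k q f).val x = true ↔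
      f x = true ∨ x ≤ N ∧ ∃ i, 1 ≤ i ∧ i ≤ k ∧ x = q + i * p := by
  induction k generalizing q f with
  | zero =>
    simp only [crossOut, Comp.val_pure]
    refine ⟨Or.inl, ?_⟩
    rintro (h | ⟨-, i, h1, h2, -⟩)
    · exact h
    · omega
  | succ k ih =>
    have hcast : (q : ℤ) + p = ((q + p : ℕ) : ℤ) := by push_cast; rfl
    by_cases h : N < q + p
    · have h' : (N : ℤ) < q + p := by exact_mod_cast h
      simp only [crossOut, Comp.val_bind, Comp.val_add, Comp.val_lt, h', decide_true, if_true,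
        Comp.val_pure]
      refine ⟨Or.inl, ?_⟩
      rintro (h1 | ⟨h1, i, h2, -, rfl⟩)
      · exact h1
      · have := Nat.mul_le_mul_right p h2
        omega
    · have h' : ¬ ((N : ℤ) < q + p) := by exact_mod_cast h
      simp only [crossOut, Comp.val_bind, Comp.val_add, Comp.val_lt, h', decide_false,
        Bool.false_eq_true, if_false, Comp.val_store]
      rw [hcast, ih, Int.toNat_natCast]
      constructor
      · rintro (h1 | ⟨h1, i, h2, h3, rfl⟩)
        · by_cases hx : x = q + p
          · exact Or.inr ⟨by omega, 1, le_rfl, by omega, by omega⟩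
          · rw [Function.update_of_ne hx] at h1
            exact Or.inl h1
        · exact Or.inr ⟨h1, i + 1, by omega, by omega, by ring⟩
      · rintro (h1 | ⟨h1, i, h2, h3, rfl⟩)
        · left
          by_cases hx : x = q + p
          · rw [hx, Function.update_self]
          · rw [Function.update_of_ne hx, h1]
        · obtain ⟨j, rfl⟩ := Nat.exists_eq_add_of_le h2
          rcases Nat.eq_zero_or_pos j with rfl | hj
          · left
            simp
          · exact Or.inr ⟨h1, j, hj, by omega, by ring⟩

theorem cost_crossOut_le {N p : ℕ} (hp : 1 ≤ p) (hpN : p ≤ N) (k q : ℕ) (hq : q ≤ N)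
    (f : ℕ → Bool) :
    (crossOut N p k q f).cost ≤ ((N - q) / p + 1) * (4 * N.size + 4) := by
  induction k generalizing q f with
  | zero => simp [crossOut]
  | succ k ih =>
    have hcast : (q : ℤ) + p = ((q + p : ℕ) : ℤ) := by push_cast; rfl
    have b1 : bits (q : ℤ) ≤ N.size := by rw [bits_natCast]; exact Nat.size_le_size hq
    have b2 : bits (p : ℤ) ≤ N.size := by rw [bits_natCast]; exact Nat.size_le_size hpN
    have b3 : bits (N : ℤ) = N.size := bits_natCast N
    have b4 := bits_add_le b1 b2
    by_cases h : N < q + p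
    · have h' : (N : ℤ) < q + p := by exact_mod_cast h
      simp only [crossOut, Comp.cost_bind, Comp.val_add, Comp.val_lt, h', decide_true,
        if_true, Comp.cost_pure, Comp.cost_add, Comp.cost_lt]
      refine le_trans ?_ (Nat.le_mul_of_pos_left _ (Nat.succ_pos _))
      omega
    · have h' : ¬ ((N : ℤ) < q + p) := by exact_mod_cast h
      have hih := ih (q + p) (by omega) (Function.update f (q + p) true)
      simp only [crossOut, Comp.cost_bind, Comp.val_add, Comp.val_lt, h', decide_false,
        Bool.false_eq_true, if_false, Comp.val_store, Comp.cost_add, Comp.cost_lt, Comp.cost_store]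
      rw [hcast, Int.toNat_natCast, ← hcast]
      have hdiv : (N - q) / p = (N - (q + p)) / p + 1 := by
        rw [← Nat.add_div_right _ (by omega)]
        congr 1
        omega
      rw [hdiv, add_mul _ 1, one_mul]
      rw [← hcast] at hih
      omega

/-- The body of the loop of `sieve`. -/
def sieveStep (N : ℕ) (f : ℕ → Bool) (p : ℕ) : Comp (ℕ → Bool) := do
  let composite ← Comp.load f p
  if composite then pure f else crossOut N p N p f

theorem sieve_eq (N : ℕ) :
    sieve N = Comp.fold (sieveStep N) (fun _ => false) (List.range' 2 (N - 1)) := rfl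

theorem not_prime_iff_exists_prime_dvd_lt {p : ℕ} (hp : 2 ≤ p) :
    ¬ p.Prime ↔ ∃ r, r.Prime ∧ r < p ∧ r ∣ p := by
  constructor
  · exact fun h => ⟨p.minFac, Nat.minFac_prime (by omega),
      (Nat.not_prime_iff_minFac_lt hp).1 h, Nat.minFac_dvd p⟩
  · rintro ⟨r, h1, h2, h3⟩ h
    rcases (Nat.dvd_prime h).1 h3 with rfl | rfl
    · exact Nat.not_prime_one h1
    · omega

/-- After 2, …, k + 1 have been treated, the marked integers are those with a proper prime divisor
in this range. Composite indices may be skipped, as only prime divisors count. The cost charges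
every index as if it were prime, which gives a harmonic sum. -/
theorem sieve_fold (N k : ℕ) (hk : k ≤ N - 1) :
    (∀ x ≤ N, (Comp.fold (sieveStep N) (fun _ => false) (List.range' 2 k)).val x = true ↔
      ∃ r, r.Prime ∧ r < k + 2 ∧ r < x ∧ r ∣ x) ∧
    (Comp.fold (sieveStep N) (fun _ => false) (List.range' 2 k)).cost ≤
      ∑ i ∈ Finset.range k, (1 + (N / (i + 2) + 1) * (4 * N.size + 4)) := by
  induction k with
  | zero =>
    refine ⟨fun x _ => ?_, by simp [Comp.fold]⟩
    simp only [List.range'_zero, Comp.fold, Comp.val_pure, Bool.false_eq_true, false_iff]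
    rintro ⟨r, h1, h2, -⟩
    have := h1.two_le
    omega
  | succ k ih =>
    obtain ⟨ih1, ih2⟩ := ih (by omega)
    rw [List.range'_concat, one_mul, add_comm 2 k]
    obtain ⟨e1, e2⟩ := Comp.fold_append (sieveStep N) (fun _ => false) (List.range' 2 k) [k + 2]
    rw [e1, e2]
    set F := (Comp.fold (sieveStep N) (fun _ => false) (List.range' 2 k)).val with hF
    have s1 : (Comp.fold (sieveStep N) F [k + 2]).val = (sieveStep N F (k + 2)).val := rfl
    have s2 : (Comp.fold (sieveStep N) F [k + 2]).cost = (sieveStep N F (k + 2)).cost := rfl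
    -- All primes below k + 2 have been treated, so the mark at k + 2 already decides its primality.
    have hFk : F (k + 2) = true ↔ ¬ (k + 2).Prime := by
      rw [ih1 _ (by omega), not_prime_iff_exists_prime_dvd_lt (by omega)]
      refine exists_congr fun r => ?_
      tauto
    rw [s1, s2, Finset.sum_range_succ]
    by_cases hp : F (k + 2) = true
    · have hnp := hFk.1 hp
      constructor
      · intro x hx
        simp only [sieveStep, Comp.val_bind, Comp.val_load, hp, if_true, Comp.val_pure]
        rw [ih1 x hx]
        refine exists_congr fun r => ?_
        constructor
        · rintro ⟨h1, h2, h3⟩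
          exact ⟨h1, by omega, h3⟩
        · rintro ⟨h1, h2, h3⟩
          refine ⟨h1, ?_, h3⟩
          rcases Nat.lt_succ_iff_lt_or_eq.1 h2 with h | rfl
          · exact h
          · exact absurd h1 hnp
      · simp only [sieveStep, Comp.cost_bind, Comp.val_load, hp, if_true, Comp.cost_pure,
          Comp.cost_load]
        omega
    · have hpr : (k + 2).Prime := by
        by_contra h
        exact hp (hFk.2 h)
      constructor
      · intro x hx
        simp only [sieveStep, Comp.val_bind, Comp.val_load, hp, Bool.false_eq_true, if_false]
        rw [val_crossOut, ih1 x hx]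
        constructor
        · rintro (⟨r, h1, h2, h3⟩ | ⟨h1, i, h2, h3, h4⟩)
          · exact ⟨r, h1, by omega, h3⟩
          · refine ⟨k + 2, hpr, by omega, ?_, ⟨i + 1, by rw [h4]; ring⟩⟩
            have := Nat.mul_le_mul_right (k + 2) h2
            omega
        · rintro ⟨r, h1, h2, h3, h4⟩
          rcases Nat.lt_succ_iff_lt_or_eq.1 h2 with h | rfl
          · exact Or.inl ⟨r, h1, h, h3, h4⟩
          · obtain ⟨c, rfl⟩ := h4
            right
            obtain ⟨i, rfl⟩ : ∃ i, c = i + 2 := by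
              refine ⟨c - 2, ?_⟩
              have : 1 < c := by
                by_contra! hc
                have := Nat.mul_le_mul_left (k + 2) hc
                omega
              omega
            refine ⟨hx, i + 1, by omega, ?_, by ring⟩
            have := Nat.mul_le_mul_right (i + 2) (show 1 ≤ k + 2 by omega)
            omega
      · simp only [sieveStep, Comp.cost_bind, Comp.val_load, hp, Bool.false_eq_true, if_false,
          Comp.cost_load]
        have h1 := cost_crossOut_le (N := N) (p := k + 2) (by omega) (by omega) N (k + 2)
          (by omega) F
        have h2 : ((N - (k + 2)) / (k + 2) + 1) * (4 * N.size + 4) ≤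
            (N / (k + 2) + 1) * (4 * N.size + 4) := by
          gcongr
          omega
        omega

theorem val_sieve {N x : ℕ} (hx : 2 ≤ x) (hxN : x ≤ N) :
    (sieve N).val x = true ↔ ¬ x.Prime := by
  rw [sieve_eq, (sieve_fold N (N - 1) le_rfl).1 x hxN, not_prime_iff_exists_prime_dvd_lt hx]
  refine exists_congr fun r => ?_
  constructor
  · rintro ⟨h1, h2, h3, h4⟩
    exact ⟨h1, h3, h4⟩
  · rintro ⟨h1, h2, h3⟩
    exact ⟨h1, by omega, h2, h3⟩

/-- The reciprocals of 2, …, N sum to at most log N, by the bound for the harmonic number without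
its first term; and log N ≤ `N.size` because log 2 ≤ 1. -/
theorem sum_div_le_mul_size (N : ℕ) (hN : 1 ≤ N) :
    ∑ i ∈ Finset.range (N - 1), N / (i + 2) ≤ N * N.size := by
  obtain ⟨n, rfl⟩ : ∃ n, N = n + 1 := ⟨N - 1, by omega⟩
  have h1 : Real.log (n + 1 : ℕ) ≤ (n + 1).size := by
    have h2 : ((n + 1 : ℕ) : ℝ) ≤ 2 ^ (n + 1).size := by
      exact_mod_cast (Nat.lt_size_self _).le
    have h3 := Real.log_le_log (by positivity) h2
    rw [Real.log_pow] at h3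
    have h4 : Real.log 2 ≤ 1 := by linarith [Real.log_two_lt_d9]
    nlinarith [Nat.cast_nonneg (α := ℝ) (n + 1).size]
  have h2 := harmonic_le_one_add_log (n + 1)
  have h3 : ((harmonic (n + 1) : ℚ) : ℝ) =
      ∑ i ∈ Finset.range n, ((i : ℝ) + 2)⁻¹ + 1 := by
    rw [harmonic, Finset.sum_range_succ']
    push_cast
    norm_num
    refine Finset.sum_congr rfl fun i _ => ?_
    norm_num [add_assoc]
  have h4 : ((∑ i ∈ Finset.range n, (n + 1) / (i + 2) : ℕ) : ℝ) ≤
      (n + 1 : ℕ) * ∑ i ∈ Finset.range n, ((i : ℝ) + 2)⁻¹ := by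
    rw [Finset.mul_sum]
    push_cast
    refine Finset.sum_le_sum fun i _ => ?_
    have := Nat.cast_div_le (α := ℝ) (m := n + 1) (n := i + 2)
    push_cast at this
    rw [← div_eq_mul_inv]
    exact_mod_cast this
  have h5 : ((∑ i ∈ Finset.range n, (n + 1) / (i + 2) : ℕ) : ℝ) ≤
      (n + 1 : ℕ) * ((n + 1).size : ℝ) := by
    refine h4.trans (mul_le_mul_of_nonneg_left ?_ (Nat.cast_nonneg _))
    linarith
  rw [Nat.add_sub_cancel]
  exact_mod_cast h5

theorem cost_sieve_le {N : ℕ} (hN : 1 ≤ N) : (sieve N).cost ≤ N * (5 * (N.size + 1) ^ 2) := by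
  rw [sieve_eq]
  refine ((sieve_fold N (N - 1) le_rfl).2).trans ?_
  rw [Finset.sum_add_distrib, ← Finset.sum_mul, Finset.sum_add_distrib]
  simp only [Finset.sum_const, Finset.card_range, smul_eq_mul, mul_one]
  have h1 := sum_div_le_mul_size N hN
  calc _ ≤ N + (N * N.size + N) * (4 * N.size + 4) := by gcongr <;> omega
    _ = N * (1 + 4 * (N.size + 1) ^ 2) := by ring
    _ ≤ _ := by
      gcongr
      have : 1 ≤ (N.size + 1) ^ 2 := Nat.one_le_pow _ _ (by omega)
      omega

/-! ### The leaves of the trees -/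

/-- The integer part of `x N / 2 ^ η`. -/
def boundary (N x : ℕ) : ℕ := x * N / 2 ^ Nat.clog 2 N

theorem boundary_mono (N : ℕ) : Monotone (boundary N) := fun _ _ h =>
  Nat.div_le_div_right (Nat.mul_le_mul_right _ h)

@[simp] theorem boundary_zero (N : ℕ) : boundary N 0 = 0 := by simp [boundary]

@[simp] theorem boundary_two_pow (N : ℕ) : boundary N (2 ^ Nat.clog 2 N) = N := by
  rw [boundary, Nat.mul_div_cancel_left _ (by positivity)]

theorem boundary_le {N x : ℕ} (hx : x ≤ 2 ^ Nat.clog 2 N) : boundary N x ≤ N := by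
  simpa using boundary_mono N hx

/-- Because N ≤ 2^η, the numerator grows by at most one denominator. This is why a leaf holds at
most one integer. -/
theorem boundary_succ_le (N x : ℕ) : boundary N (x + 1) ≤ boundary N x + 1 := by
  have h : N ≤ 2 ^ Nat.clog 2 N := Nat.le_pow_clog (by norm_num) _
  rw [boundary, boundary, ← Nat.add_div_right _ (by positivity)]
  apply Nat.div_le_div_right
  rw [add_mul, one_mul]
  omega

theorem clog_le_size {N : ℕ} : Nat.clog 2 N ≤ N.size :=
  Nat.clog_le_of_le_pow (Nat.lt_size_self N).le

theorem val_leafIndex (I : ℕ → SLP) (N j : ℕ) :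
    (leafIndex I N (Nat.clog 2 N) j).val =
      if boundary N j < boundary N (j + 1) then some (boundary N (j + 1) : ℤ) else none := by
  have h1 : (j : ℤ) * N / 2 ^ Nat.clog 2 N = (boundary N j : ℤ) := by
    rw [boundary]; push_cast; rfl
  have h2 : ((j : ℤ) * N + N) / 2 ^ Nat.clog 2 N = (boundary N (j + 1) : ℤ) := by
    rw [boundary]; push_cast; rw [add_mul, one_mul]
  simp only [leafIndex, Comp.val_bind, Comp.val_mul, Comp.val_shr, Comp.val_add, Comp.val_lt,
    Comp.val_pure, h1, h2, Nat.cast_lt, decide_eq_true_eq]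

theorem cost_leafIndex_le (I : ℕ → SLP) {N j : ℕ} (hj : j < 2 ^ Nat.clog 2 N) :
    (leafIndex I N (Nat.clog 2 N) j).cost ≤ 15 * arithCost I N.size := by
  have hs := succ_le_arithCost I N.size
  have h1 : bits (j : ℤ) ≤ N.size := by
    rw [bits_natCast, Nat.size_le]
    exact hj.trans_le (Nat.pow_le_pow_right (by norm_num) clog_le_size)
  have h2 : bits (N : ℤ) = N.size := bits_natCast N
  have h3 := cost_mul_le I h1 h2.le
  have h4 := bits_mul_le (j : ℤ) N
  have h5 : bits ((j : ℤ) * N + N) ≤ 2 * N.size + 1 := bits_add_le (by omega) (by omega)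
  have h6 := bits_shr_le ((j : ℤ) * N) (Nat.clog 2 N)
  have h7 := bits_shr_le ((j : ℤ) * N + N) (Nat.clog 2 N)
  have h8 := clog_le_size (N := N)
  simp only [leafIndex, Comp.cost_bind, Comp.val_mul, Comp.val_shr, Comp.val_add,
    Comp.cost_shr, Comp.cost_add, Comp.cost_lt, Comp.cost_pure]
  omega

/-! ### Products of translates and of primes over intervals -/

/-- The matrix `M(θ + k)`. -/
noncomputable def shiftMat {m : ℕ} (M : Matrix (Fin m) (Fin m) ℤ[X]) (k : ℕ) :
    Matrix (Fin m) (Fin m) ℤ[X] :=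
  M.map (fun Q => Q.comp (X + C (k : ℤ)))

/-- The matrix `M(θ + a + 1) ⋯ M(θ + b)`. -/
noncomputable def shiftProd {m : ℕ} (M : Matrix (Fin m) (Fin m) ℤ[X]) (a b : ℕ) :
    Matrix (Fin m) (Fin m) ℤ[X] :=
  ((List.range' (a + 1) (b - a)).map (shiftMat M)).prod

section ShiftProd

variable {m : ℕ} (M : Matrix (Fin m) (Fin m) ℤ[X])

@[simp] theorem shiftProd_self (a : ℕ) : shiftProd M a a = 1 := by simp [shiftProd]

theorem shiftProd_succ (a : ℕ) : shiftProd M a (a + 1) = shiftMat M (a + 1) := by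
  simp [shiftProd]

theorem shiftProd_mul {a b c : ℕ} (hab : a ≤ b) (hbc : b ≤ c) :
    shiftProd M a b * shiftProd M b c = shiftProd M a c := by
  obtain ⟨e, rfl⟩ := Nat.exists_eq_add_of_le hab
  obtain ⟨f, rfl⟩ := Nat.exists_eq_add_of_le hbc
  have h1 : a + e - a = e := by omega
  have h2 : a + e + f - (a + e) = f := by omega
  have h3 : a + e + f - a = e + f := by omega
  have h4 : a + e + 1 = a + 1 + e := by omega
  rw [shiftProd, shiftProd, shiftProd, h1, h2, h3, h4, ← List.prod_append, ← List.map_append,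
    List.range'_append_1]

/-- The trees only see indices k ≥ 1, so the factor of index 0 is split off on the left. -/
theorem matFactorial_eq {p : ℕ} (hp : 1 ≤ p) : matFactorial M p = M * shiftProd M 0 (p - 1) := by
  obtain ⟨q, rfl⟩ : ∃ q, p = q + 1 := ⟨p - 1, by omega⟩
  have h0 : shiftMat M 0 = M := by
    ext i j : 2
    simp [shiftMat]
  have h1 : matFactorial M (q + 1) = ((List.range' 0 (q + 1)).map (shiftMat M)).prod := by
    rw [matFactorial, List.range_eq_range']
    simp only [List.bind_eq_flatMap, List.pure_def, ← List.map_eq_flatMap, List.map_map]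
    rfl
  rw [h1, List.range'_succ, List.map_cons, List.prod_cons, h0]
  rfl

end ShiftProd

/-- The product of the primes `k` with `a < k ≤ b`. -/
def primeProd (a b : ℕ) : ℤ := ∏ k ∈ Finset.Ioc a b, if k.Prime then (k : ℤ) else 1

theorem primeProd_mul {a b c : ℕ} (hab : a ≤ b) (hbc : b ≤ c) :
    primeProd a b * primeProd b c = primeProd a c :=
  Finset.prod_Ioc_consecutive _ hab hbc

theorem primeProd_succ (a : ℕ) :
    primeProd a (a + 1) = if (a + 1).Prime then ((a + 1 : ℕ) : ℤ) else 1 := by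
  rw [primeProd, Nat.Ioc_succ_singleton, Finset.prod_singleton]

theorem primeProd_self (a : ℕ) : primeProd a a = 1 := by simp [primeProd]

theorem primeProd_pos (a b : ℕ) : 0 < primeProd a b := by
  refine Finset.prod_pos fun k _ => ?_
  split_ifs with h
  · exact_mod_cast h.pos
  · norm_num

theorem boundary_cases (N j : ℕ) : boundary N (j + 1) = boundary N j ∨
    boundary N (j + 1) = boundary N j + 1 := by
  have h1 := boundary_succ_le N j
  have h2 := boundary_mono N (Nat.le_add_right j 1)
  omega

theorem val_leafS (I : ℕ → SLP) {N j : ℕ} (hj : j < 2 ^ Nat.clog 2 N) :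
    (leafS I N (Nat.clog 2 N) (sieve N).val j).val =
      primeProd (boundary N j) (boundary N (j + 1)) := by
  have hle := boundary_le (show j + 1 ≤ 2 ^ Nat.clog 2 N from hj)
  simp only [leafS, Comp.val_bind, val_leafIndex]
  rcases boundary_cases N j with h | h
  · rw [h, if_neg (lt_irrefl _), primeProd_self]
    rfl
  · rw [h] at hle
    rw [h, if_pos (Nat.lt_succ_self _), primeProd_succ]
    simp only [Comp.val_bind, Comp.val_load, Comp.val_pure, Int.toNat_natCast]
    -- The sieve does not mark 1, although it is not prime; this is harmless, since both branches of
    -- the leaf then give 1.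
    rcases Nat.eq_zero_or_pos (boundary N j) with h0 | h0
    · rw [h0]
      simp
    · have hs := val_sieve (N := N) (x := boundary N j + 1) (by omega) hle
      by_cases hp : (boundary N j + 1).Prime
      · rw [if_pos hp]
        exact if_neg fun h => hs.1 h hp
      · rw [if_neg hp]
        exact if_pos (hs.2 hp)

/-! ### Product trees -/

/-- If a product at height h + 1 costs at most 2^h K, halving the number of nodes offsets the growth
of the operands, and each of the `h` levels costs at most 2^h K for a tree of height `h`. `H` is the
number of available leaves. -/
theorem productTree_spec {α : Type} {mul : α → α → Comp α} {leaf : ℕ → Comp α}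
    {r : ℕ → ℕ → α → Prop} {H c K : ℕ}
    (hleaf : ∀ j < H, r 0 j (leaf j).val ∧ (leaf j).cost ≤ c)
    (hmul : ∀ h j a b, (j + 1) * 2 ^ (h + 1) ≤ H → r h (2 * j) a → r h (2 * j + 1) b →
      r (h + 1) j (mul a b).val ∧ (mul a b).cost ≤ 2 ^ h * K)
    (h j : ℕ) (hj : (j + 1) * 2 ^ h ≤ H) :
    r h j (productTree mul leaf h j).val.root ∧
    (productTree mul leaf h j).cost ≤ 2 ^ h * c + h * (2 ^ h * K) := by
  induction h generalizing j with
  | zero =>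
    obtain ⟨h1, h2⟩ := hleaf j (by simpa using hj)
    exact ⟨h1, by simpa [productTree] using h2⟩
  | succ h ih =>
    have hj1 : (2 * j + 1) * 2 ^ h ≤ H := le_trans (by
      rw [pow_succ, mul_comm (2 ^ h), ← mul_assoc]; exact Nat.mul_le_mul_right _ (by omega)) hj
    have hj2 : (2 * j + 1 + 1) * 2 ^ h ≤ H := le_trans (by
      rw [pow_succ, mul_comm (2 ^ h), ← mul_assoc]; exact Nat.mul_le_mul_right _ (by omega)) hj
    obtain ⟨l1, l2⟩ := ih (2 * j) hj1
    obtain ⟨r1, r2⟩ := ih (2 * j + 1) hj2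
    obtain ⟨m1, m2⟩ := hmul h j _ _ hj l1 r1
    refine ⟨m1, ?_⟩
    simp only [productTree, Comp.cost_bind, Comp.cost_pure]
    have e : 2 ^ (h + 1) * c + (h + 1) * (2 ^ (h + 1) * K) =
      (2 ^ h * c + h * (2 ^ h * K)) + (2 ^ h * c + h * (2 ^ h * K)) + 2 ^ h * K + 2 ^ h * K := by
      ring
    rw [e]
    linarith [Nat.zero_le (2 ^ h * K)]

/-- The data of the algorithm together with parameters for the cost estimate: `β` bounds the bit
sizes at the leaves, `Q` the polynomial products, `κ` the arithmetic on integers at each level of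
the trees, and `l` the logarithmic factors. -/
structure Setup (I P A : ℕ → SLP) (m d n N β Q κ l : ℕ) (M : Matrix (Fin m) (Fin m) ℤ[X]) :
    Prop where
  hP : ∀ d, MultipliesPolynomials d (P d)
  hA : ∀ m, MultipliesMatrices m (A m)
  hm : 1 ≤ m
  hd : 1 ≤ d
  hN : 2 ≤ N
  deg : ∀ i j, (M i j).degree < d
  coeff : CoeffBits d n M
  hQ : PolyCost P d Q
  -- The first three summands bound the translated coefficients, `m.size + d.size` is the growth in
  -- one matrix product, and `N.size` bounds a prime leaf.
  hβ : n + d.size + d * (N + 1).size + m.size + d.size + N.size + 2 ≤ β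
  -- Quasi-linearity of integer arithmetic enters the trees only here. The factor 64 covers all
  -- intermediate sizes, the largest being 8·6·2^h β + 16 in a division.
  hκ : ∀ h ≤ Nat.clog 2 N, arithCost I (64 * (2 ^ h * β)) ≤ 2 ^ h * κ
  hl : Nat.clog 2 (64 * (2 ^ Nat.clog 2 N * β)) + 2 ≤ l
  hld : Nat.clog 2 d + 1 ≤ l
  hlN : N.size + 1 ≤ l

namespace Setup

variable {I P A : ℕ → SLP} {m d n N β Q κ l : ℕ} {M : Matrix (Fin m) (Fin m) ℤ[X]}

/-- The cost factor of matrices with polynomial entries. -/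
def matCost (A : ℕ → SLP) (m d Q : ℕ) : ℕ := ((A m).length + m * m) * (Q * d)

theorem mul_self_mul_le (hs : Setup I P A m d n N β Q κ l M) :
    m * m * d ≤ matCost A m d Q := by
  have := hs.hQ.1
  calc m * m * d ≤ ((A m).length + m * m) * d := by gcongr; omega
    _ ≤ _ := Nat.mul_le_mul_left _ (Nat.le_mul_of_pos_left _ this)

theorem one_le_matCost (hs : Setup I P A m d n N β Q κ l M) : 1 ≤ matCost A m d Q :=
  le_trans (Nat.mul_pos (Nat.mul_pos hs.hm hs.hm) hs.hd) hs.mul_self_mul_le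

theorem arithCost_le (hs : Setup I P A m d n N β Q κ l M) {h b : ℕ} (hh : h ≤ Nat.clog 2 N)
    (hb : b ≤ 64 * (2 ^ h * β)) : arithCost I b ≤ 2 ^ h * κ :=
  (arithCost_mono I hb).trans (hs.hκ h hh)

theorem le_kappa (hs : Setup I P A m d n N β Q κ l M) : β + 1 ≤ κ := by
  have h1 := hs.hκ 0 (Nat.zero_le _)
  have h2 := succ_le_arithCost I (64 * (2 ^ 0 * β))
  rw [pow_zero, one_mul, one_mul] at *
  omega

theorem le_two_pow_mul (β h : ℕ) : β ≤ 2 ^ h * β :=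
  Nat.le_mul_of_pos_left _ (by positivity)

theorem matMul_le (hs : Setup I P A m d n N β Q κ l M) {h : ℕ} (hh : h ≤ Nat.clog 2 N)
    {X Y : Matrix (Fin m) (Fin m) ℤ[X]} (hX : CoeffBits d (2 * (2 ^ h * β)) X)
    (hY : CoeffBits d (2 * (2 ^ h * β)) Y) :
    (matMul I P A m d (encode d X) (encode d Y)).val = encode d (X * Y) ∧
    (matMul I P A m d (encode d X) (encode d Y)).cost ≤
      2 ^ h * (24 * (matCost A m d Q * κ)) := by
  obtain ⟨h1, h2⟩ := matMul_spec (I := I) hs.hP hs.hA hs.hd hX hY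
  refine ⟨h1, h2.trans ?_⟩
  have hβ := hs.hβ
  have h3 := le_two_pow_mul β h
  have h4 := hs.arithCost_le hh
    (b := 2 * (2 * (2 ^ h * β)) + m.size + d.size + 2) (by omega)
  have h5 := hs.hQ.2 d hs.hd le_rfl
  calc _ ≤ ((A m).length + m * m) * (Q * d) * (24 * (2 ^ h * κ)) := by gcongr
    _ = _ := by rw [matCost]; ring

theorem matMod_le (hs : Setup I P A m d n N β Q κ l M) {h : ℕ} (hh : h ≤ Nat.clog 2 N)
    {X : Matrix (Fin m) (Fin m) ℤ[X]} (hX : CoeffBits d (6 * (2 ^ h * β)) X) {S : ℤ} (hS : 0 < S)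
    (hSb : bits S ≤ 6 * (2 ^ h * β)) :
    (matMod I (encode d X) S).val = encode d (X.map (reducePoly S)) ∧
    (matMod I (encode d X) S).cost ≤ 2 ^ h * (16 * (matCost A m d Q * l * κ)) := by
  obtain ⟨h1, h2⟩ := matMod_spec I hX hS hSb
  refine ⟨h1, h2.trans ?_⟩
  have hβ := hs.hβ
  have h3 := le_two_pow_mul β h
  have h4 := hs.arithCost_le hh (b := 8 * (6 * (2 ^ h * β)) + 16) (by omega)
  have h5 : Nat.clog 2 (6 * (2 ^ h * β)) + 2 ≤ l := by
    refine le_trans (Nat.add_le_add_right (Nat.clog_mono_right 2 ?_) 2) hs.hl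
    have : 2 ^ h * β ≤ 2 ^ Nat.clog 2 N * β :=
      Nat.mul_le_mul_right _ (Nat.pow_le_pow_right (by norm_num) hh)
    omega
  calc _ ≤ m * m * (d * (l * (16 * (2 ^ h * κ)))) := by gcongr
    _ = (m * m * d) * (l * (16 * (2 ^ h * κ))) := by ring
    _ ≤ matCost A m d Q * (l * (16 * (2 ^ h * κ))) :=
      Nat.mul_le_mul_right _ hs.mul_self_mul_le
    _ = _ := by ring

/-- What the node `(h, j)` of the tree `T` satisfies, counting the levels from the leaves. -/
def NodeT (d N β : ℕ) (M : Matrix (Fin m) (Fin m) ℤ[X]) (h j : ℕ) (a : List (List ℤ)) : Prop :=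
  a = encode d (shiftProd M (boundary N (j * 2 ^ h)) (boundary N ((j + 1) * 2 ^ h))) ∧
  ∃ b, b + m.size + d.size ≤ 2 ^ h * β ∧
    CoeffBits d b (shiftProd M (boundary N (j * 2 ^ h)) (boundary N ((j + 1) * 2 ^ h)))

/-- What the node `(h, j)` of the tree `S` satisfies, counting the levels from the leaves. -/
def NodeS (N β : ℕ) (h j : ℕ) (a : ℤ) : Prop :=
  a = primeProd (boundary N (j * 2 ^ h)) (boundary N ((j + 1) * 2 ^ h)) ∧ bits a ≤ 2 ^ h * β

theorem index_left (h j : ℕ) : 2 * j * 2 ^ h = j * 2 ^ (h + 1) := by ring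

theorem index_right (h j : ℕ) : (2 * j + 1 + 1) * 2 ^ h = (j + 1) * 2 ^ (h + 1) := by ring

theorem le_mid (N h j : ℕ) :
    boundary N (j * 2 ^ (h + 1)) ≤ boundary N ((2 * j + 1) * 2 ^ h) := by
  rw [← index_left]
  exact boundary_mono N (Nat.mul_le_mul_right _ (by omega))

theorem mid_le (N h j : ℕ) :
    boundary N ((2 * j + 1) * 2 ^ h) ≤ boundary N ((j + 1) * 2 ^ (h + 1)) := by
  rw [← index_right]
  exact boundary_mono N (Nat.mul_le_mul_right _ (by omega))

theorem height_le {h j N : ℕ} (hj : (j + 1) * 2 ^ h ≤ 2 ^ Nat.clog 2 N) : h ≤ Nat.clog 2 N :=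
  (Nat.pow_le_pow_iff_right (by norm_num)).1
    ((Nat.le_mul_of_pos_left _ (Nat.succ_pos j)).trans hj)

theorem leafT_spec (hs : Setup I P A m d n N β Q κ l M) {j : ℕ} (hj : j < 2 ^ Nat.clog 2 N) :
    NodeT d N β M 0 j (leafT I P m d N (Nat.clog 2 N) (encode d M) j).val ∧
    (leafT I P m d N (Nat.clog 2 N) (encode d M) j).cost ≤
      79 * (matCost A m d Q * l * κ) := by
  have hβ := hs.hβ
  have hl := hs.hl
  have hle := boundary_le (show j + 1 ≤ 2 ^ Nat.clog 2 N from hj)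
  have hk := hs.arithCost_le (h := 0) (b := N.size) (Nat.zero_le _) (by omega)
  rw [pow_zero, one_mul] at hk
  have hidx := cost_leafIndex_le I hj
  have h1 : κ ≤ matCost A m d Q * l * κ :=
    Nat.le_mul_of_pos_left _ (Nat.mul_pos hs.one_le_matCost (by omega))
  simp only [NodeT, pow_zero, mul_one, one_mul, leafT, Comp.val_bind, Comp.cost_bind,
    val_leafIndex]
  rcases boundary_cases N j with h | h
  · rw [h, if_neg (lt_irrefl _), shiftProd_self]
    refine ⟨⟨oneMat_eq m hs.hd, 1, by omega, coeffBits_one m d⟩, ?_⟩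
    simp only [Comp.cost_pure]
    omega
  · rw [h, if_pos (Nat.lt_succ_self _), shiftProd_succ]
    set k := boundary N j + 1 with hkdef
    have hsz : bits ((k : ℤ) + 1) ≤ (N + 1).size := by
      rw [show (k : ℤ) + 1 = ((k + 1 : ℕ) : ℤ) by push_cast; rfl, bits_natCast]
      exact Nat.size_le_size (by omega)
    have hsz' := Nat.mul_le_mul_left d hsz
    have htr := fun i j => translate_spec I hs.hP hs.hd hs.hQ (hs.deg i j) (hs.coeff i j)
      (a := (k : ℤ)) (Int.natCast_nonneg k)
    refine ⟨⟨?_, n + d.size + d * bits ((k : ℤ) + 1), by omega, ?_⟩, ?_⟩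
    · rw [Comp.val_map, encode, encode, map_entryList]
      exact entryList_congr fun i j => (htr i j).1
    · intro i j c hc
      exact bits_coeff_comp_le hs.hd (hs.deg i j) (hs.coeff i j) (Int.natCast_nonneg k) c
    · have hk2 := hs.arithCost_le (h := 0)
        (b := n + d.size + d * bits ((k : ℤ) + 1) + 2) (Nat.zero_le _) (by omega)
      rw [pow_zero, one_mul] at hk2
      have h2 : (Comp.map (translate I P d k) (encode d M)).cost ≤
          m * m * (l * (d * (Q * (64 * κ)))) := by
        refine (Comp.cost_map_le _ _ (l * (d * (Q * (64 * κ)))) fun f hf => ?_).trans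
          (by rw [encode, length_entryList])
        obtain ⟨i, j, rfl⟩ := mem_entryList.1 hf
        refine (htr i j).2.trans ?_
        have := hs.hld
        gcongr
      have h3 : m * m * (l * (d * (Q * (64 * κ)))) ≤ 64 * (matCost A m d Q * l * κ) := by
        calc _ = (m * m) * (Q * d) * (64 * (l * κ)) := by ring
          _ ≤ ((A m).length + m * m) * (Q * d) * (64 * (l * κ)) := by gcongr; omega
          _ = _ := by rw [matCost]; ring
      show _ + (Comp.map (translate I P d k) (encode d M)).cost ≤ _
      omega

theorem nodeT_spec (hs : Setup I P A m d n N β Q κ l M) (h j : ℕ)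
    (hj : (j + 1) * 2 ^ h ≤ 2 ^ Nat.clog 2 N) :
    NodeT d N β M h j (productTree (matMul I P A m d)
      (leafT I P m d N (Nat.clog 2 N) (encode d M)) h j).val.root ∧
    (productTree (matMul I P A m d) (leafT I P m d N (Nat.clog 2 N) (encode d M)) h j).cost ≤
      2 ^ h * (79 * (matCost A m d Q * l * κ)) +
        h * (2 ^ h * (24 * (matCost A m d Q * κ))) := by
  refine productTree_spec (r := NodeT d N β M) (fun j hj => hs.leafT_spec hj) ?_ h j hj
  rintro h j _ _ hj ⟨rfl, b, hb, hbX⟩ ⟨rfl, b', hb', hbY⟩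
  have hh : h ≤ Nat.clog 2 N := (Nat.le_succ h).trans (height_le hj)
  obtain ⟨h1, h2⟩ := hs.matMul_le hh (hbX.mono (by omega)) (hbY.mono (by omega))
  have hXY := hbX.mul hbY
  rw [index_left, index_right] at h1 h2 hXY
  rw [shiftProd_mul M (le_mid N h j) (mid_le N h j)] at h1 hXY
  rw [index_left, index_right]
  -- The sizes b and b' of the factors both leave room for `m.size + d.size`: one reserve pays for
  -- the growth in the product, the other is the reserve of the parent.
  exact ⟨⟨h1, _, by rw [pow_succ]; linarith, hXY⟩, h2⟩

theorem nodeS_spec (hs : Setup I P A m d n N β Q κ l M) (h j : ℕ)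
    (hj : (j + 1) * 2 ^ h ≤ 2 ^ Nat.clog 2 N) :
    NodeS N β h j (productTree (Comp.mul I)
      (leafS I N (Nat.clog 2 N) (sieve N).val) h j).val.root ∧
    (productTree (Comp.mul I) (leafS I N (Nat.clog 2 N) (sieve N).val) h j).cost ≤
      2 ^ h * (16 * κ) + h * (2 ^ h * (2 * κ)) := by
  have hβ := hs.hβ
  refine productTree_spec (r := NodeS N β) (fun j hj => ?_) ?_ h j hj
  · have hle := boundary_le (show j + 1 ≤ 2 ^ Nat.clog 2 N from hj)
    have hk := hs.arithCost_le (h := 0) (b := N.size) (Nat.zero_le _) (by omega)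
    rw [pow_zero, one_mul] at hk
    have hidx := cost_leafIndex_le I hj
    have hκ := hs.le_kappa
    refine ⟨⟨by rw [val_leafS I hj, pow_zero, mul_one, mul_one], ?_⟩, ?_⟩
    · rw [val_leafS I hj, pow_zero, one_mul]
      rcases boundary_cases N j with h | h
      · rw [h, primeProd_self, bits_one]
        omega
      · rw [h] at hle
        rw [h, primeProd_succ]
        split_ifs
        · rw [bits_natCast]
          exact (Nat.size_le_size hle).trans (by omega)
        · rw [bits_one]
          omega
    · simp only [leafS, Comp.cost_bind, val_leafIndex]
      split_ifs
      · simp only [Comp.cost_bind, Comp.cost_load, Comp.cost_pure]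
        omega
      · simp only [Comp.cost_pure]
        omega
  · rintro h j a b hj ⟨ha, ha'⟩ ⟨hb, hb'⟩
    have hh : h ≤ Nat.clog 2 N := (Nat.le_succ h).trans (height_le hj)
    have h1 := hs.arithCost_le hh (b := 2 ^ h * β) (by omega)
    have h2 := cost_mul_le I ha' hb'
    refine ⟨⟨?_, ?_⟩, by linarith⟩
    · rw [Comp.val_mul, ha, hb, index_left, index_right,
        primeProd_mul (le_mid N h j) (mid_le N h j)]
    · refine (bits_mul_le a b).trans ?_
      rw [pow_succ]
      linarith

end Setup

/-! ### The descent and the whole algorithm -/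

theorem primeProd_succ_of_prime {a p : ℕ} (hp : p.Prime) (h : a + 1 = p) : primeProd a (a + 1) = p := by
  rw [primeProd_succ, h, if_pos hp]

namespace Setup

variable {I P A : ℕ → SLP} {m d n N β Q κ l : ℕ} {M : Matrix (Fin m) (Fin m) ℤ[X]}

/-- The hypothesis `hc` is the invariant of the descent. The second conclusion, that other prime
addresses are untouched, protects the results of the left subtree from the right one. Reduction
modulo the S of the child restores the size bound 2^h β. -/
theorem descend_spec (hs : Setup I P A m d n N β Q κ l M) (h j : ℕ)
    (hj : (j + 1) * 2 ^ h ≤ 2 ^ Nat.clog 2 N) (W : Matrix (Fin m) (Fin m) ℤ[X])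
    (hW : CoeffBits d (2 ^ h * β) W)
    (hc : CongrMod d (primeProd (boundary N (j * 2 ^ h)) (boundary N ((j + 1) * 2 ^ h))) W
      (shiftProd M 0 (boundary N (j * 2 ^ h)))) (mem : ℕ → List (List ℤ))
    {r : Comp (ℕ → List (List ℤ))}
    (hr : r = descend I P A m d
      (productTree (matMul I P A m d) (leafT I P m d N (Nat.clog 2 N) (encode d M)) h j).val
      (productTree (Comp.mul I) (leafS I N (Nat.clog 2 N) (sieve N).val) h j).val
      (encode d W) mem) :
    (∀ p, p.Prime → boundary N (j * 2 ^ h) < p → p ≤ boundary N ((j + 1) * 2 ^ h) →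
      ∃ V : Matrix (Fin m) (Fin m) ℤ[X], r.val p = encode d V ∧ CoeffBits d β V ∧
        CongrMod d p V (shiftProd M 0 (p - 1))) ∧
    (∀ p, p.Prime → (p ≤ boundary N (j * 2 ^ h) ∨ boundary N ((j + 1) * 2 ^ h) < p) →
      r.val p = mem p) ∧
    r.cost ≤ 2 ^ h + h * (2 ^ h * (56 * (matCost A m d Q * l * κ))) := by
  induction h generalizing j W mem r with
  | zero =>
    have hjlt : j < 2 ^ Nat.clog 2 N := by simpa using hj
    have hr' : r = Comp.store mem
        (leafS I N (Nat.clog 2 N) (sieve N).val j).val.toNat (encode d W) := hr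
    rw [val_leafS I hjlt] at hr'
    simp only [pow_zero, mul_one, one_mul] at *
    subst hr'
    simp only [Comp.val_store, Comp.cost_store]
    refine ⟨fun p hp h1 h2 => ?_, fun p hp h1 => ?_, by omega⟩
    · have hb : boundary N (j + 1) = boundary N j + 1 := by
        have := boundary_succ_le N j
        omega
      have hpb : boundary N j + 1 = p := by omega
      rw [hb, primeProd_succ_of_prime hp hpb] at hc ⊢
      rw [Int.toNat_natCast, Function.update_self]
      refine ⟨W, rfl, hW, ?_⟩
      rwa [show boundary N j = p - 1 by omega] at hc
    -- A leaf writes at its own prime or, if its S is the empty product, at address 1, which is not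
    -- prime.
    · rw [Function.update_of_ne]
      rcases boundary_cases N j with hb | hb
      · rw [hb, primeProd_self]
        exact hp.ne_one
      · rw [hb, primeProd_succ]
        split_ifs
        · rw [Int.toNat_natCast]
          omega
        · exact hp.ne_one
  | succ h ih =>
    have hh : h ≤ Nat.clog 2 N := (Nat.le_succ h).trans (height_le hj)
    have hj2 : (2 * j + 1 + 1) * 2 ^ h ≤ 2 ^ Nat.clog 2 N := (index_right h j).trans_le hj
    have hj1 : (2 * j + 1) * 2 ^ h ≤ 2 ^ Nat.clog 2 N :=
      (Nat.mul_le_mul_right _ (by omega)).trans hj2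
    have hβ := hs.hβ
    have h2β := le_two_pow_mul β h
    have hlm := le_mid N h j
    have hmr := mid_le N h j
    obtain ⟨⟨tl1, b, hb, tl2⟩, -⟩ := hs.nodeT_spec h (2 * j) hj1
    obtain ⟨⟨sl1, sl2⟩, -⟩ := hs.nodeS_spec h (2 * j) hj1
    obtain ⟨⟨sr1, sr2⟩, -⟩ := hs.nodeS_spec h (2 * j + 1) hj2
    have ihl := ih (2 * j) hj1
    have ihr := ih (2 * j + 1) hj2
    rw [index_left] at tl1 tl2 sl1 ihl
    rw [index_right] at sr1 ihr
    set lo := boundary N (j * 2 ^ (h + 1)) with hlo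
    set mid := boundary N ((2 * j + 1) * 2 ^ h) with hmid
    set hi := boundary N ((j + 1) * 2 ^ (h + 1)) with hhi
    set tl := (productTree (matMul I P A m d)
      (leafT I P m d N (Nat.clog 2 N) (encode d M)) h (2 * j)).val with htl
    set tr := (productTree (matMul I P A m d)
      (leafT I P m d N (Nat.clog 2 N) (encode d M)) h (2 * j + 1)).val with htr
    set sl := (productTree (Comp.mul I)
      (leafS I N (Nat.clog 2 N) (sieve N).val) h (2 * j)).val with hsl
    set sr := (productTree (Comp.mul I)
      (leafS I N (Nat.clog 2 N) (sieve N).val) h (2 * j + 1)).val with hsr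
    have hr' : r = (do
        let Wl ← matMod I (encode d W) sl.root
        let Z ← matMul I P A m d (encode d W) tl.root
        let Wr ← matMod I Z sr.root
        let mem' ← descend I P A m d tl sl Wl mem
        descend I P A m d tr sr Wr mem') := hr
    have hW2 : CoeffBits d (2 * (2 ^ h * β)) W := by
      rw [pow_succ] at hW
      exact hW.mono (by linarith)
    have hSl : 0 < sl.root := sl1 ▸ primeProd_pos _ _
    have hSr : 0 < sr.root := sr1 ▸ primeProd_pos _ _
    obtain ⟨a1, a2⟩ := hs.matMod_le hh (hW2.mono (by omega)) hSl (by omega)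
    obtain ⟨b1, b2⟩ := hs.matMul_le hh hW2 (tl2.mono (by omega))
    have hZ := hW2.mul tl2
    rw [← tl1] at b1 b2
    obtain ⟨c1, c2⟩ := hs.matMod_le hh (hZ.mono (by omega)) hSr (by omega)
    rw [← b1] at c1 c2
    have hprod := primeProd_mul hlm hmr
    set X := descend I P A m d tl sl (matMod I (encode d W) sl.root).val mem with hX
    set Y := descend I P A m d tr sr
      (matMod I (matMul I P A m d (encode d W) tl.root).val sr.root).val X.val with hY
    obtain ⟨l1, l2, l3⟩ := ihl (W.map (reducePoly sl.root))
      ((coeffBits_reduce d W hSl).mono sl2)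
      (sl1 ▸ (CongrMod.reduce W).trans (hc.of_dvd ⟨_, by rw [sl1]; exact hprod.symm⟩)) mem
      (r := X) (by rw [hX, a1])
    -- For the right child, the invariant holds because multiplication by T of the left child
    -- extends the product from `lo` to `mid`.
    obtain ⟨r1, r2, r3⟩ := ihr ((W * shiftProd M lo mid).map (reducePoly sr.root))
      ((coeffBits_reduce d _ hSr).mono sr2)
      (by
        rw [← sr1]
        refine (CongrMod.reduce _).trans ?_
        rw [← shiftProd_mul M (Nat.zero_le lo) hlm]
        refine CongrMod.mul (hc.of_dvd ⟨primeProd lo mid, ?_⟩) (CongrMod.refl _)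
        rw [sr1, mul_comm]
        exact hprod.symm)
      X.val (r := Y) (by rw [hY, c1])
    have hval : r.val = Y.val := by rw [hr']; rfl
    have hcost : r.cost = (matMod I (encode d W) sl.root).cost +
        ((matMul I P A m d (encode d W) tl.root).cost +
        ((matMod I (matMul I P A m d (encode d W) tl.root).val sr.root).cost +
        (X.cost + Y.cost))) := by rw [hr']; rfl
    rw [hval, hcost]
    refine ⟨fun p hp h1 h2 => ?_, fun p hp h1 => ?_, ?_⟩
    · rcases le_or_gt p mid with h3 | h3
      · rw [r2 p hp (Or.inl h3)]
        exact l1 p hp h1 h3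
      · exact r1 p hp h3 h2
    · rw [r2 p hp (by omega), l2 p hp (by omega)]
    · have hl : 1 ≤ l := by have := hs.hl; omega
      have e1 : 2 ^ h * (24 * (matCost A m d Q * κ)) ≤
          2 ^ h * (24 * (matCost A m d Q * l * κ)) := by
        gcongr
        exact Nat.le_mul_of_pos_right _ hl
      -- 56 = 16 + 24 + 16 accounts for the two reductions and the product at this node.
      have e2 : 2 ^ (h + 1) + (h + 1) * (2 ^ (h + 1) * (56 * (matCost A m d Q * l * κ))) =
          2 * (2 ^ h + h * (2 ^ h * (56 * (matCost A m d Q * l * κ)))) +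
          2 * (2 ^ h * (56 * (matCost A m d Q * l * κ))) := by ring
      rw [e2]
      linarith [Nat.zero_le (2 ^ h * (matCost A m d Q * l * κ))]

/-- One factor `l` comes from the height of the trees, the other from the Newton steps of the
divisions and the levels of the translation. The root has interval (0, N], so W = 1 satisfies the
invariant trivially. -/
theorem matrixFactorial_spec (hs : Setup I P A m d n N β Q κ l M) {primes : List ℕ}
    (hnodup : primes.Nodup) (hprimes : ∀ p ∈ primes, p.Prime ∧ p < N) :
    (matrixFactorial I P A m d N (encode d M) primes).val =
      primes.map (fun p => encodeMod p d (matFactorial M p)) ∧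
    (matrixFactorial I P A m d N (encode d M) primes).cost ≤
      2 ^ Nat.clog 2 N * (224 * (matCost A m d Q * l ^ 2 * κ)) := by
  set η := Nat.clog 2 N with hη
  have hβ := hs.hβ
  have hκ := hs.le_kappa
  set T := productTree (matMul I P A m d) (leafT I P m d N η (encode d M)) η 0 with hT
  set S := productTree (Comp.mul I) (leafS I N η (sieve N).val) η 0 with hS
  set W := descend I P A m d T.val S.val (oneMat m d) (fun _ => []) with hW
  set fin := fun p : ℕ => (do
      let w ← Comp.load W.val p
      let z ← matMul I P A m d (encode d M) w
      matMod I z p) with hfin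
  have hval : (matrixFactorial I P A m d N (encode d M) primes).val =
    (Comp.map fin primes).val := rfl
  have hcost : (matrixFactorial I P A m d N (encode d M) primes).cost =
    (sieve N).cost + (T.cost + (S.cost + (W.cost + (Comp.map fin primes).cost))) := rfl
  have h0 : (0 + 1) * 2 ^ η ≤ 2 ^ Nat.clog 2 N := by rw [zero_add, one_mul]
  obtain ⟨-, hTc⟩ := hs.nodeT_spec η 0 h0
  obtain ⟨-, hSc⟩ := hs.nodeS_spec η 0 h0
  have hβη := le_two_pow_mul β η
  obtain ⟨w1, -, w3⟩ := hs.descend_spec η 0 h0 1 ((coeffBits_one m d).mono (by omega))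
    (by
      rw [zero_mul, boundary_zero, shiftProd_self]
      exact CongrMod.refl _) (fun _ => []) (r := W) (by rw [← oneMat_eq m hs.hd])
  rw [zero_mul, boundary_zero, zero_add, one_mul, hη, boundary_two_pow] at w1
  set G := matCost A m d Q with hG
  have hG1 : 1 ≤ G := hs.one_le_matCost
  have hl1 : 1 ≤ l := by have := hs.hl; omega
  have hstep : ∀ p ∈ primes, (fin p).val = encodeMod p d (matFactorial M p) ∧
      (fin p).cost ≤ 41 * (G * l * κ) := by
    intro p hpm
    obtain ⟨hp, hpN⟩ := hprimes p hpm
    obtain ⟨V, v1, v2, v3⟩ := w1 p hp hp.pos hpN.le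
    have hM : CoeffBits d β M := hs.coeff.mono (by omega)
    obtain ⟨m1, m2⟩ := hs.matMul_le (h := 0) (Nat.zero_le _) (hM.mono (by omega))
      (v2.mono (by omega))
    obtain ⟨r1, r2⟩ := hs.matMod_le (h := 0) (Nat.zero_le _) ((hM.mul v2).mono (by omega))
      (S := p) (by exact_mod_cast hp.pos) (by
        rw [bits_natCast]
        have := Nat.size_le_size hpN.le
        omega)
    have f1 : (fin p).val = (matMod I (matMul I P A m d (encode d M) (W.val p)).val p).val := rfl
    have f2 : (fin p).cost = 1 + ((matMul I P A m d (encode d M) (W.val p)).cost +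
      (matMod I (matMul I P A m d (encode d M) (W.val p)).val p).cost) := rfl
    rw [f1, f2, v1, m1, r1]
    constructor
    · rw [encodeMod_eq, matFactorial_eq M hp.pos]
      exact ((CongrMod.refl M).mul v3).encode_reduce_eq
    · rw [pow_zero, one_mul] at m2 r2
      have e1 : G * κ ≤ G * l * κ := by gcongr; exact Nat.le_mul_of_pos_right _ hl1
      have e2 : 1 ≤ G * l * κ := Nat.mul_pos (Nat.mul_pos hG1 hl1) (by omega)
      linarith
  constructor
  · rw [hval, Comp.val_map]
    exact List.map_congr_left fun p hp => (hstep p hp).1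
  · have hN2 : N ≤ 2 ^ η := Nat.le_pow_clog (by norm_num) _
    -- The list has no repetitions and its elements are below N, so the final products are no more
    -- numerous than the leaves.
    have hlen : primes.length ≤ N := by
      have h1 := (List.toFinset_card_of_nodup hnodup).symm
      rw [h1]
      refine (Finset.card_le_card (t := Finset.range N) fun p hp => ?_).trans (by simp)
      exact Finset.mem_range.2 (hprimes p (List.mem_toFinset.1 hp)).2
    have c1 : (Comp.map fin primes).cost ≤ 2 ^ η * (41 * (G * l * κ)) :=
      (Comp.cost_map_le _ _ _ fun p hp => (hstep p hp).2).trans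
        (Nat.mul_le_mul_right _ (hlen.trans hN2))
    have c2 : (sieve N).cost ≤ 2 ^ η * (5 * (G * l * κ)) := by
      refine (cost_sieve_le (by have := hs.hN; omega)).trans ?_
      have h1 := hs.hlN
      have h2 : N.size + 1 ≤ κ := by omega
      calc _ ≤ 2 ^ η * (5 * (l * κ)) := by
            rw [pow_two]; gcongr
        _ ≤ 2 ^ η * (5 * (G * (l * κ))) := by
            exact Nat.mul_le_mul_left _
              (Nat.mul_le_mul_left _ (Nat.le_mul_of_pos_left _ hG1))
        _ = _ := by rw [mul_assoc G]
    have hηl : η ≤ l := (clog_le_size (N := N)).trans (by have := hs.hlN; omega)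
    have e1 : G * κ ≤ G * l * κ := by gcongr; exact Nat.le_mul_of_pos_right _ hl1
    have e2 : κ ≤ G * l * κ := Nat.le_mul_of_pos_left _ (Nat.mul_pos hG1 hl1)
    have e3 : 1 ≤ G * l * κ := Nat.mul_pos (Nat.mul_pos hG1 hl1) (by omega)
    set Z := G * l * κ with hZ
    rw [hcost]
    calc _ ≤ 2 ^ η * (5 * Z) + (2 ^ η * (79 * Z) + η * (2 ^ η * (24 * (G * κ))) +
          (2 ^ η * (16 * κ) + η * (2 ^ η * (2 * κ)) +
          (2 ^ η + η * (2 ^ η * (56 * Z)) + 2 ^ η * (41 * Z)))) := by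
            linarith
      _ ≤ 2 ^ η * (5 * Z) + (2 ^ η * (79 * Z) + l * (2 ^ η * (24 * Z)) +
          (2 ^ η * (16 * Z) + l * (2 ^ η * (2 * Z)) +
          (2 ^ η * Z + l * (2 ^ η * (56 * Z)) + 2 ^ η * (41 * Z)))) := by
            gcongr
            exact Nat.le_mul_of_pos_right _ e3
      _ = 142 * (2 ^ η * Z) * 1 + 82 * (2 ^ η * Z) * l := by ring
      _ ≤ 142 * (2 ^ η * Z) * l + 82 * (2 ^ η * Z) * l := by gcongr
      _ = 2 ^ η * (224 * (G * l ^ 2 * κ)) := by rw [hZ]; ring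

end Setup

/-! ### The asymptotic estimate -/

theorem size_le_one_add_log {k : ℕ} (hk : 1 ≤ k) : (k.size : ℝ) ≤ 1 + 2 * Real.log k := by
  have hs : 0 < k.size := Nat.size_pos.2 hk
  obtain ⟨e, he⟩ : ∃ e, k.size = e + 1 := ⟨k.size - 1, by omega⟩
  have h1 : 2 ^ e ≤ k := Nat.lt_size.1 (by omega)
  have h2 : ((2 : ℝ) ^ e) ≤ k := by exact_mod_cast h1
  have h3 := Real.log_le_log (by positivity) h2
  rw [Real.log_pow] at h3
  have h4 : (1 : ℝ) / 2 ≤ Real.log 2 := by linarith [Real.log_two_gt_d9]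
  have h5 : (e : ℝ) * (1 / 2) ≤ e * Real.log 2 := by gcongr
  rw [he]
  push_cast
  linarith

theorem size_le_self (k : ℕ) : k.size ≤ k := Nat.size_le.2 Nat.lt_two_pow_self

theorem size_succ_le (k : ℕ) : (k + 1).size ≤ k.size + 1 := by
  rw [Nat.size_le, pow_succ]
  have := Nat.lt_size_self k
  omega

/-- At argument 1 the logarithm vanishes, so the bound is the constant itself. -/
theorem softBound_const_nonneg {f : ℕ → ℕ} {C : ℝ} {k : ℕ} {g : ℝ} (hg : g = 1)
    (h : (f 1 : ℝ) ≤ softBound C k g) : 0 ≤ C := by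
  rw [softBound, hg, Real.log_one] at h
  have : (0 : ℝ) ≤ f 1 := Nat.cast_nonneg _
  simp at h
  linarith

theorem softBound_le {C x y L : ℝ} {k : ℕ} (hC : 0 ≤ C) (hx : 1 ≤ x) (hxy : x ≤ y)
    (hL : 1 + Real.log y ≤ L) : softBound C k x ≤ C * x * L ^ k := by
  have h1 := Real.log_nonneg hx
  have h2 := Real.log_le_log (by linarith) hxy
  rw [softBound]
  have h3 : (1 + Real.log x) ^ k ≤ L ^ k := pow_le_pow_left₀ (by linarith) (by linarith) k
  exact mul_le_mul_of_nonneg_left h3 (mul_nonneg hC (by linarith))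

/-- The circuit `I 0` is outside the asymptotic hypothesis and enters as a constant. The factor `w`
depends on `b` only through a bound for its logarithm, so one `w` serves all heights of the tree. -/
theorem arithCost_le_mul {I : ℕ → SLP} {C L : ℝ} {k b w : ℕ} (hb : 1 ≤ b) (hC : 0 ≤ C)
    (hI : ∀ n : ℕ, 1 ≤ n → ((I n).length : ℝ) ≤ softBound C k n)
    (hL : 1 + Real.log b ≤ L) (hw : (I 0).length + C * L ^ k + 2 ≤ w) :
    arithCost I b ≤ b * w := by
  have hb' : (1 : ℝ) ≤ b := by exact_mod_cast hb
  have hL0 : 0 ≤ L := by linarith [Real.log_nonneg hb']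
  have hCL : 0 ≤ C * L ^ k := by positivity
  obtain ⟨i, hi, hsup⟩ := Finset.exists_mem_eq_sup (Finset.range (b + 1))
    ⟨0, by simp⟩ (fun i => (I i).length)
  rw [Finset.mem_range] at hi
  have hlen : ((I i).length : ℝ) ≤ b * ((I 0).length + C * L ^ k) := by
    rcases Nat.eq_zero_or_pos i with rfl | hi0
    · have h0 : (0 : ℝ) ≤ (I 0).length := Nat.cast_nonneg _
      nlinarith
    · have hi1 : (1 : ℝ) ≤ i := by exact_mod_cast hi0
      have hib : (i : ℝ) ≤ b := by exact_mod_cast Nat.lt_succ_iff.1 hi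
      refine (hI i hi0).trans ((softBound_le hC hi1 hib hL).trans ?_)
      have h0 : (0 : ℝ) ≤ (I 0).length := Nat.cast_nonneg _
      calc C * i * L ^ k = i * (C * L ^ k) := by ring
        _ ≤ b * ((I 0).length + C * L ^ k) := by gcongr; linarith
  have : (arithCost I b : ℝ) ≤ b * w := by
    rw [arithCost, hsup]
    push_cast
    calc ((I i).length : ℝ) + b + 1 ≤ b * ((I 0).length + C * L ^ k) + b + b := by linarith
      _ = b * ((I 0).length + C * L ^ k + 2) := by ring
      _ ≤ b * w := by gcongr
  exact_mod_cast this

theorem polyCost_of_softBound {P : ℕ → SLP} {C L : ℝ} {k d Q : ℕ} (hC : 0 ≤ C)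
    (hP : ∀ d : ℕ, 1 ≤ d → ((P d).length : ℝ) ≤ softBound C k d)
    (hL : 1 + Real.log d ≤ L) (hL0 : 0 ≤ L) (hQ : C * L ^ k + 1 ≤ Q) : PolyCost P d Q := by
  have hCL : 0 ≤ C * L ^ k := by positivity
  refine ⟨by exact_mod_cast (by linarith : (1 : ℝ) ≤ Q), fun e he hed => ?_⟩
  have he1 : (1 : ℝ) ≤ e := by exact_mod_cast he
  have h1 := (hP e he).trans (softBound_le hC he1 (by exact_mod_cast hed : (e : ℝ) ≤ d) hL)
  have : ((P e).length : ℝ) + e ≤ Q * e := by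
    calc _ ≤ C * e * L ^ k + e := by linarith
      _ = (C * L ^ k + 1) * e := by ring
      _ ≤ Q * e := by gcongr
  exact_mod_cast this

/-- The bound for the bit sizes at the leaves of the trees. -/
def leafBits (m d n N : ℕ) : ℕ :=
  n + d.size + d * (N + 1).size + m.size + d.size + N.size + 2

/-- Additive constants and multiples of `d` are absorbed by d log N, because log N ≥ 1/2. -/
theorem leafBits_le {m d n N : ℕ} (hm : 1 ≤ m) (hd : 1 ≤ d) (hN : 2 ≤ N) :
    (leafBits m d n N : ℝ) ≤ 20 * (n + d * Real.log N + Real.log m) := by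
  have hd' : (1 : ℝ) ≤ d := by exact_mod_cast hd
  have hlogN : (1 : ℝ) / 2 ≤ Real.log N := by
    have h1 : Real.log 2 ≤ Real.log N :=
      Real.log_le_log (by norm_num) (by exact_mod_cast hN)
    linarith [Real.log_two_gt_d9]
  have hlogm : 0 ≤ Real.log m := Real.log_nonneg (by exact_mod_cast hm)
  have h1 : (d.size : ℝ) ≤ d := by exact_mod_cast size_le_self d
  have h2 := size_le_one_add_log (show 1 ≤ N by omega)
  have h3 : ((N + 1).size : ℝ) ≤ 2 + 2 * Real.log N := by
    have : ((N + 1).size : ℝ) ≤ N.size + 1 := by exact_mod_cast size_succ_le N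
    linarith
  have h4 := size_le_one_add_log hm
  have h5 : (d : ℝ) * (N + 1).size ≤ d * (2 + 2 * Real.log N) := by gcongr
  have h6 : (d : ℝ) * (1 / 2) ≤ d * Real.log N := by gcongr
  have h7 : Real.log N ≤ d * Real.log N := le_mul_of_one_le_left (by linarith) hd'
  have hn : (0 : ℝ) ≤ n := Nat.cast_nonneg n
  rw [leafBits]
  push_cast
  linarith

theorem two_pow_clog_le {N : ℕ} (hN : 2 ≤ N) : 2 ^ Nat.clog 2 N ≤ 2 * N := by
  have h1 := Nat.pow_pred_clog_lt_self (b := 2) (by norm_num) (show 1 < N by omega)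
  have h2 : 0 < Nat.clog 2 N := Nat.clog_pos (by norm_num) hN
  obtain ⟨c, hc⟩ : ∃ c, Nat.clog 2 N = c + 1 := ⟨Nat.clog 2 N - 1, by omega⟩
  rw [hc, Nat.pred_succ] at h1
  rw [hc, pow_succ]
  omega

/-- Each factor is its share of X times a power of Λ; the exponent 2 comes from `l ^ 2`. -/
theorem cost_product_le {t N a q d l β w μ Λ Y cA cP cI : ℝ} {kA kP kI : ℕ} (ht : 0 ≤ t)
    (ha : 0 ≤ a) (hq : 0 ≤ q) (hd : 0 ≤ d) (hl : 0 ≤ l) (hβ : 0 ≤ β) (hw : 0 ≤ w)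
    (htN : t ≤ 2 * N) (haA : a ≤ cA * μ * Λ ^ kA) (hqP : q ≤ cP * Λ ^ kP) (hlΛ : l ≤ 52 * Λ)
    (hβY : β ≤ 20 * Y) (hwI : w ≤ cI * Λ ^ kI) :
    t * (224 * (a * (q * d) * l ^ 2 * (64 * β * w))) ≤
      (2 * 224 * 64 * 20 * 52 ^ 2 * cA * cP * cI) * (μ * d * N * Y) *
        Λ ^ (kA + kP + kI + 2) := by
  have h1 : q * d ≤ cP * Λ ^ kP * d := mul_le_mul_of_nonneg_right hqP hd
  have h2 : a * (q * d) ≤ cA * μ * Λ ^ kA * (cP * Λ ^ kP * d) :=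
    mul_le_mul haA h1 (mul_nonneg hq hd) (ha.trans haA)
  have h3 : l ^ 2 ≤ (52 * Λ) ^ 2 := pow_le_pow_left₀ hl hlΛ 2
  have h4 : a * (q * d) * l ^ 2 ≤ cA * μ * Λ ^ kA * (cP * Λ ^ kP * d) * (52 * Λ) ^ 2 :=
    mul_le_mul h2 h3 (sq_nonneg l) ((mul_nonneg ha (mul_nonneg hq hd)).trans h2)
  have h5 : β * w ≤ 20 * Y * (cI * Λ ^ kI) := mul_le_mul hβY hwI hw (hβ.trans hβY)
  have h6 := mul_le_mul h4 h5 (mul_nonneg hβ hw)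
    ((mul_nonneg (mul_nonneg ha (mul_nonneg hq hd)) (sq_nonneg l)).trans h4)
  have h7 := mul_le_mul htN h6 (mul_nonneg (mul_nonneg (mul_nonneg ha (mul_nonneg hq hd))
    (sq_nonneg l)) (mul_nonneg hβ hw)) (ht.trans htN)
  calc _ = 224 * 64 * (t * (a * (q * d) * l ^ 2 * (β * w))) := by ring
    _ ≤ 224 * 64 * (2 * N * (cA * μ * Λ ^ kA * (cP * Λ ^ kP * d) * (52 * Λ) ^ 2 *
        (20 * Y * (cI * Λ ^ kI)))) := mul_le_mul_of_nonneg_left h7 (by norm_num)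
    _ = _ := by ring

theorem matrixFactorial_val_cost {ω : ℝ} (hω : 2 ≤ ω) {I P A : ℕ → SLP}
    (hP : ∀ d, MultipliesPolynomials d (P d)) (hA : ∀ m, MultipliesMatrices m (A m))
    {CI CP CA : ℝ} {kI kP kA : ℕ}
    (hI_cost : ∀ n : ℕ, 1 ≤ n → ((I n).length : ℝ) ≤ softBound CI kI n)
    (hP_cost : ∀ d : ℕ, 1 ≤ d → ((P d).length : ℝ) ≤ softBound CP kP d)
    (hA_cost : ∀ m : ℕ, 1 ≤ m → ((A m).length : ℝ) ≤ softBound CA kA ((m : ℝ) ^ ω))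
    {m d n N : ℕ} (hm : 1 ≤ m) (hd : 1 ≤ d) (hN : 2 ≤ N) {M : Matrix (Fin m) (Fin m) ℤ[X]}
    (hdeg : ∀ i j, (M i j).degree < d) (hbits : ∀ i j c, bits ((M i j).coeff c) ≤ n)
    {primes : List ℕ} (hnodup : primes.Nodup) (hprimes : ∀ p ∈ primes, p.Prime ∧ p < N) :
    (matrixFactorial I P A m d N (encode d M) primes).val =
        primes.map (fun p => encodeMod p d (matFactorial M p)) ∧
    ((matrixFactorial I P A m d N (encode d M) primes).cost : ℝ) ≤
      softBound (2 * 224 * 64 * 20 * 52 ^ 2 * (CA + 1) * (CP + 2) *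
        ((I 0).length + CI * 13 ^ kI + 3)) (kA + kP + kI + 2) (costScale ω m d n N) := by
  have hCI : 0 ≤ CI := softBound_const_nonneg (f := fun i => (I i).length) (by simp)
    (hI_cost 1 le_rfl)
  have hCP : 0 ≤ CP := softBound_const_nonneg (f := fun i => (P i).length) (by simp)
    (hP_cost 1 le_rfl)
  have hCA : 0 ≤ CA := softBound_const_nonneg (f := fun i => (A i).length) (by simp)
    (hA_cost 1 le_rfl)
  set β := leafBits m d n N with hβ
  set Y : ℝ := n + d * Real.log N + Real.log m with hY
  set x := costScale ω m d n N with hx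
  set η := Nat.clog 2 N with hη
  set Λ := 1 + Real.log x with hΛ
  have hm' : (1 : ℝ) ≤ m := by exact_mod_cast hm
  have hd' : (1 : ℝ) ≤ d := by exact_mod_cast hd
  have hN' : (2 : ℝ) ≤ N := by exact_mod_cast hN
  have hmω : (1 : ℝ) ≤ (m : ℝ) ^ ω := Real.one_le_rpow hm' (by linarith)
  -- Here ω ≥ 2 makes the linear work on the m² entries negligible against the matrix product.
  have hm2 : (m : ℝ) * m ≤ (m : ℝ) ^ ω := by
    rw [← sq, ← Real.rpow_natCast]
    exact Real.rpow_le_rpow_of_exponent_le hm' (by exact_mod_cast hω)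
  have hxY : x = (m : ℝ) ^ ω * d * N * Y := rfl
  have hβY : (β : ℝ) ≤ 20 * Y := leafBits_le hm hd hN
  have hYhalf : (1 : ℝ) / 2 ≤ Y := by
    have h1 : (1 : ℝ) / 2 ≤ Real.log N := by
      have h1 : Real.log 2 ≤ Real.log N := Real.log_le_log (by norm_num) hN'
      linarith [Real.log_two_gt_d9]
    have h2 : Real.log N ≤ d * Real.log N := le_mul_of_one_le_left (by linarith) hd'
    have h3 := Real.log_nonneg hm'
    have h4 : (0 : ℝ) ≤ n := Nat.cast_nonneg n
    linarith
  have hNY : 1 ≤ N * Y := by nlinarith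
  have hmd : 1 ≤ (m : ℝ) ^ ω * d := one_le_mul_of_one_le_of_one_le hmω hd'
  have hNYx : N * Y ≤ x := by
    rw [hxY, mul_assoc]
    exact le_mul_of_one_le_left (by linarith) hmd
  have hmdx : (m : ℝ) ^ ω * d ≤ x := by
    rw [hxY, mul_assoc]
    exact le_mul_of_one_le_right (by linarith) hNY
  have hmx : (m : ℝ) ^ ω ≤ x := (le_mul_of_one_le_right (by linarith) hd').trans hmdx
  have hdx : (d : ℝ) ≤ x := (le_mul_of_one_le_left (by linarith) hmω).trans hmdx
  have hx1 : 1 ≤ x := hNY.trans hNYx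
  have hΛ1 : 1 ≤ Λ := by linarith [Real.log_nonneg hx1]
  have h2η : (2 : ℝ) ^ η ≤ 2 * N := by exact_mod_cast two_pow_clog_le hN
  set B := 64 * (2 ^ η * β) with hB
  have hβ2 : 2 ≤ β := by rw [hβ, leafBits]; omega
  have hNη : N ≤ 2 ^ η := Nat.le_pow_clog (by norm_num) _
  have hηB : 2 ^ η ≤ B := by nlinarith [Nat.one_le_two_pow (n := η)]
  have hNB : N ≤ B := hNη.trans hηB
  have hdB : d ≤ B := by
    have h1 : d ≤ d * (N + 1).size :=
      Nat.le_mul_of_pos_right _ (Nat.size_pos.2 (Nat.succ_pos N))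
    have h2 : d ≤ β := by rw [hβ, leafBits]; omega
    have h3 : β ≤ 2 ^ η * β := Setup.le_two_pow_mul β η
    omega
  have hB1 : 1 ≤ B := by omega
  have hBx : (B : ℝ) ≤ 2 ^ 12 * x := by
    rw [hB]
    push_cast
    calc (64 : ℝ) * (2 ^ η * β) ≤ 64 * ((2 * N) * (20 * Y)) := by gcongr
      _ = 2560 * (N * Y) := by ring
      _ ≤ 2 ^ 12 * x := by nlinarith
  -- `B` is the largest bit size considered. It is at most 2^12 X, and log 2 ≤ 1, so its logarithm
  -- exceeds log X by at most 12.
  have hlogB : 1 + Real.log B ≤ 13 * Λ := by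
    have h1 := Real.log_le_log (by exact_mod_cast hB1) hBx
    rw [Real.log_mul (by norm_num) (by linarith), Real.log_pow] at h1
    have h2 : Real.log 2 ≤ 1 := by linarith [Real.log_two_lt_d9]
    push_cast at h1
    rw [hΛ]
    linarith [Real.log_nonneg hx1]
  set l := B.size + 3 with hl
  -- 52 = 4·13, from `l` ≤ 4 + 2 log B.
  have hl52 : (l : ℝ) ≤ 52 * Λ := by
    have := size_le_one_add_log hB1
    rw [hl]
    push_cast
    linarith [Real.log_nonneg (show (1 : ℝ) ≤ B by exact_mod_cast hB1)]
  set w := ⌈(I 0).length + CI * (13 * Λ) ^ kI + 2⌉₊ with hw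
  set Q := ⌈CP * Λ ^ kP + 1⌉₊ with hQ
  have hdΛ : 1 + Real.log d ≤ Λ := by
    rw [hΛ]
    linarith [Real.log_le_log (by linarith) hdx]
  have hsetup : Setup I P A m d n N β Q (64 * β * w) l M :=
    { hP := hP
      hA := hA
      hm := hm
      hd := hd
      hN := hN
      deg := hdeg
      coeff := fun i j c _ => hbits i j c
      hQ := polyCost_of_softBound hCP hP_cost hdΛ (by linarith) (Nat.le_ceil _)
      hβ := le_rfl
      hκ := by
        intro h hh
        have h1 : 64 * (2 ^ h * β) ≤ B := by
          rw [hB]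
          gcongr
          norm_num
        have h2 : 1 ≤ 64 * (2 ^ h * β) := by
          have := Setup.le_two_pow_mul β h
          omega
        have h3 : 1 + Real.log (64 * (2 ^ h * β) : ℕ) ≤ 13 * Λ := by
          refine le_trans (add_le_add_right (Real.log_le_log ?_ ?_) 1) hlogB
          · exact_mod_cast h2
          · exact_mod_cast h1
        refine (arithCost_le_mul h2 hCI hI_cost h3 (Nat.le_ceil _)).trans_eq ?_
        ring
      hl := by
        have : Nat.clog 2 B ≤ B.size := clog_le_size
        change Nat.clog 2 B + 2 ≤ l
        omega
      hld := by
        have h1 : Nat.clog 2 B ≤ B.size := clog_le_size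
        have h2 := Nat.clog_mono_right 2 hdB
        omega
      hlN := by
        have := Nat.size_le_size hNB
        omega }
  obtain ⟨hval, hcost⟩ := hsetup.matrixFactorial_spec hnodup hprimes
  refine ⟨hval, ?_⟩
  have hΛI : 1 ≤ Λ ^ kI := one_le_pow₀ hΛ1
  have hΛP : 1 ≤ Λ ^ kP := one_le_pow₀ hΛ1
  have hΛA : 1 ≤ Λ ^ kA := one_le_pow₀ hΛ1
  have hI0 : (0 : ℝ) ≤ (I 0).length := Nat.cast_nonneg _
  have hwΛ : (w : ℝ) ≤ ((I 0).length + CI * 13 ^ kI + 3) * Λ ^ kI := by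
    have h1 := (Nat.ceil_lt_add_one
      (show 0 ≤ (I 0).length + CI * (13 * Λ) ^ kI + 2 by positivity)).le
    rw [mul_pow] at h1
    have h2 : ((I 0).length + 3 : ℝ) ≤ ((I 0).length + 3) * Λ ^ kI :=
      le_mul_of_one_le_right (by positivity) hΛI
    rw [hw, mul_pow]
    linarith
  have hQΛ : (Q : ℝ) ≤ (CP + 2) * Λ ^ kP := by
    have h1 := (Nat.ceil_lt_add_one (show 0 ≤ CP * Λ ^ kP + 1 by positivity)).le
    rw [hQ]
    linarith
  have hAΛ : ((A m).length : ℝ) + m * m ≤ (CA + 1) * (m : ℝ) ^ ω * Λ ^ kA := by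
    have h1 := (hA_cost m hm).trans (softBound_le (k := kA) hCA hmω hmx le_rfl)
    have h2 : (m : ℝ) ^ ω ≤ (m : ℝ) ^ ω * Λ ^ kA := le_mul_of_one_le_right (by linarith) hΛA
    linarith
  have hcost' : ((matrixFactorial I P A m d N (encode d M) primes).cost : ℝ) ≤
      2 ^ η * (224 * ((((A m).length : ℝ) + m * m) * (Q * d) * l ^ 2 * (64 * β * w))) := by
    have := (Nat.cast_le (α := ℝ)).2 hcost
    rw [Setup.matCost] at this
    push_cast at this
    exact this
  exact hcost'.trans (cost_product_le (by positivity) (by positivity) (by positivity)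
    (by positivity) (by positivity) (by positivity) (by positivity) h2η hAΛ hQΛ hl52 hβY hwΛ)

end RemainderTree

theorem mainTheorem3
    (ω : ℝ) (hω : 2 ≤ ω)
    (I P A : ℕ → RemainderTree.SLP)
    (hI : ∀ n, RemainderTree.MultipliesIntegers n (I n))
    (hP : ∀ d, RemainderTree.MultipliesPolynomials d (P d))
    (hA : ∀ m, RemainderTree.MultipliesMatrices m (A m))
    (hI_cost : ∃ (C : ℝ) (k : ℕ), ∀ n : ℕ, 1 ≤ n →
      ((I n).length : ℝ) ≤ RemainderTree.softBound C k n)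
    (hP_cost : ∃ (C : ℝ) (k : ℕ), ∀ d : ℕ, 1 ≤ d →
      ((P d).length : ℝ) ≤ RemainderTree.softBound C k d)
    (hA_cost : ∃ (C : ℝ) (k : ℕ), ∀ m : ℕ, 1 ≤ m →
      ((A m).length : ℝ) ≤ RemainderTree.softBound C k ((m : ℝ) ^ ω)) :
    ∃ (C : ℝ) (k : ℕ), ∀ (m d n N : ℕ), 1 ≤ m → 1 ≤ d → 2 ≤ N →
      ∀ M : Matrix (Fin m) (Fin m) (Polynomial ℤ),
        (∀ i j, (M i j).degree < d) →
        (∀ i j c, RemainderTree.bits ((M i j).coeff c) ≤ n) →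
      ∀ primes : List ℕ, primes.Nodup → (∀ p ∈ primes, p.Prime ∧ p < N) →
        (RemainderTree.matrixFactorial I P A m d N (RemainderTree.encode d M) primes).val =
            primes.map (fun p => RemainderTree.encodeMod p d (RemainderTree.matFactorial M p)) ∧
        ((RemainderTree.matrixFactorial I P A m d N (RemainderTree.encode d M) primes).cost : ℝ) ≤
            RemainderTree.softBound C k (RemainderTree.costScale ω m d n N) := by
  obtain ⟨CI, kI, hI_cost⟩ := hI_cost
  obtain ⟨CP, kP, hP_cost⟩ := hP_cost
  obtain ⟨CA, kA, hA_cost⟩ := hA_cost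
  exact ⟨_, _, fun m d n N hm hd hN M hdeg hbits primes hnodup hprimes =>
    RemainderTree.matrixFactorial_val_cost hω hP hA hI_cost hP_cost hA_cost hm hd hN hdeg hbits
      hnodup hprimes⟩
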